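/- Let $\Sigma=\{0,1\}$ and let FP be the set of total functions computable in polynomial time (by Turing machines, where tuples of strings are encoded in a standard way). For a total function $\sigma:\Sigma^*\times\Sigma^*\to\Sigma^*$ say that - $\sigma$ is *honest* if there is a polynomial $q$ such that every $z\in\mathrm{image}(\sigma)$ has $a,b\in\Sigma^*$ with $\sigma(a,b)=z$ and $|a|+|b|\le q(|z|)$; - $\sigma$ is *s-honest* if there is a polynomial $q$ such that, for all $z,a$, if $\sigma(a,b)=z$ for some $b$, then $\sigma(a,b')=z$ for some $b'$ with $|b'|\le q(|z|+|a|)$; and, for all $z,b$, if $\sigma(a,b)=z$ for some $a$, then $\sigma(a',b)=z$ for some $a'$ with $|a'|\le q(|z|+|b|)$; - $\sigma$ is *noninvertible* if there is no $g:\Sigma^*\to\Sigma^*\times\Sigma^*$ in FP with $\sigma(g(z))=z$ for all $z\in\mathrm{image}(\sigma)$; - $\sigma$ is *strongly noninvertible* if there is no $g_1\in\mathrm{FP}$ such that $\sigma(a,g_1(a,z))=z$ whenever $z=\sigma(a,b)$ for some $b$, and there is no $g_2\in\mathrm{FP}$ such that $\sigma(g_2(b,z),b)=z$ whenever $z=\sigma(a,b)$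 for some $a$; - $\sigma$ is *overstrong* if there is no $f:\{1,2\}\times\Sigma^*\times\Sigma^*\to\Sigma^*\times\Sigma^*$ in FP such that for all $i\in\{1,2\}$ and $z,a\in\Sigma^*$: if there is $b\in\Sigma^*$ with ($i=1$ and $\sigma(a,b)=z$) or ($i=2$ and $\sigma(b,a)=z$), then $\sigma(f(i,z,a))=z$. **Theorem.** If $\mathrm{P}\ne\mathrm{NP}$, then there is a total, polynomial-time computable, honest, s-honest and commutative function $\sigma:\Sigma^*\times\Sigma^*\to\Sigma^*$ that is noninvertible and strongly noninvertible but not overstrong. In particular, if $\mathrm{P}\ne\mathrm{NP}$, then being both one-way (honest, polynomial-time computable, noninvertible) and strongly one-way (s-honest, polynomial-time computable, strongly noninvertible) does not imply being overstrong. -/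

import Mathlib

namespace PolyOneWay

/-- Strings over the binary alphabet. -/
abbrev Str : Type := List Bool

/-- `PolyTime ea eb f`: some multi-stack Turing machine, started on the tape contents `ea x`,
halts within a number of steps bounded by a polynomial in the length of `ea x`, with `eb (f x)`
as its output. -/
def PolyTime {α β Γ Δ : Type} (ea : α → List Γ) (eb : β → List Δ) (f : α → β) : Prop :=
  Nonempty (Turing.TM2ComputableInPolyTime ea eb f)

/-- The tape contents for a string: the string itself. -/
def encStr (x : Str) : List Bool := x

/-- The tape contents for a truth value: one bit. -/
def encBool (b : Bool) : List Bool := [b]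

/-- The tape contents `x # y` for a pair of strings; `none` is the separator `#`. -/
def encPair (p : Str × Str) : List (Option Bool) :=
  p.1.map some ++ none :: p.2.map some

/-- The tape contents `i x # y` for an index with two values and two strings. The index `i` is
one bit. -/
def encIdxPair (t : Fin 2 × Str × Str) : List (Option Bool) :=
  some (decide (t.1 = 1)) :: encPair t.2

/-- The class P of languages over the binary alphabet. -/
def ClassP : Set (Language Bool) :=
  {L | ∃ d : Str → Bool, PolyTime encStr encBool d ∧ ∀ x, x ∈ L ↔ d x = true}

/-- The class NP of languages over the binary alphabet: membership has certificates of polynomially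
bounded length that can be checked in polynomial time. -/
def ClassNP : Set (Language Bool) :=
  {L | ∃ (q : Polynomial ℕ) (v : Str × Str → Bool), PolyTime encPair encBool v ∧
    ∀ x, x ∈ L ↔ ∃ w : Str, w.length ≤ q.eval x.length ∧ v (x, w) = true}

/-! All functions below are total 2-ary functions on strings, so that the domain of `σ` is the set
of all pairs of strings. -/

/-- The 2-ary function `σ` is computable in polynomial time. -/
def PolyTimeComputable (σ : Str × Str → Str) : Prop :=
  PolyTime encPair encStr σ

/-- Every image element has a preimage of polynomially bounded length. -/
def Honest (σ : Str × Str → Str) : Prop :=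
  ∃ q : Polynomial ℕ, ∀ z ∈ Set.range σ, ∃ a b : Str,
    a.length + b.length ≤ q.eval z.length ∧ σ (a, b) = z

/-- Honesty with respect to each single argument when the other one is given. -/
def SHonest (σ : Str × Str → Str) : Prop :=
  ∃ q : Polynomial ℕ,
    (∀ z a : Str, (∃ b, σ (a, b) = z) →
      ∃ b', b'.length ≤ q.eval (z.length + a.length) ∧ σ (a, b') = z) ∧
    (∀ z b : Str, (∃ a, σ (a, b) = z) →
      ∃ a', a'.length ≤ q.eval (z.length + b.length) ∧ σ (a', b) = z)

/-- No polynomial-time function maps every image element to one of its preimages. -/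
def Noninvertible (σ : Str × Str → Str) : Prop :=
  ¬ ∃ g : Str → Str × Str, PolyTime encStr encPair g ∧ ∀ z ∈ Set.range σ, σ (g z) = z

/-- A polynomial-time function finds a suitable second argument from the first argument and
the image element. -/
def InvertibleFirst (σ : Str × Str → Str) : Prop :=
  ∃ g₁ : Str × Str → Str, PolyTime encPair encStr g₁ ∧
    ∀ z ∈ Set.range σ, ∀ a b : Str, σ (a, b) = z → σ (a, g₁ (a, z)) = z

/-- A polynomial-time function finds a suitable first argument from the second argument and
the image element. -/
def InvertibleSecond (σ : Str × Str → Str) : Prop :=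
  ∃ g₂ : Str × Str → Str, PolyTime encPair encStr g₂ ∧
    ∀ z ∈ Set.range σ, ∀ a b : Str, σ (a, b) = z → σ (g₂ (b, z), b) = z

/-- `σ` is invertible neither with respect to its first nor with respect to its second
argument. -/
def StronglyNoninvertible (σ : Str × Str → Str) : Prop :=
  ¬ InvertibleFirst σ ∧ ¬ InvertibleSecond σ

/-- No polynomial-time function finds, from an image element `z` and a first argument
(index `0`) or a second argument (index `1`) that can be completed to a preimage of `z`,
some preimage of `z`. -/
def Overstrong (σ : Str × Str → Str) : Prop :=
  ¬ ∃ f : Fin 2 × Str × Str → Str × Str, PolyTime encIdxPair encPair f ∧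
    ∀ (i : Fin 2) (z a : Str),
      (∃ b : Str, (σ (a, b) = z ∧ i = 0) ∨ (σ (b, a) = z ∧ i = 1)) → σ (f (i, z, a)) = z

end PolyOneWay

/-! If P ≠ NP, there is an honest polynomial-time function ρ of one argument without a
polynomial-time inverter (`exists_oneWay`): it maps a coded pair of an instance x and a valid
certificate w to 1x, so that inverting it decides an NP language outside P.

The function σ is `hardSum ρ`. It has the values σ(0u, 0u) = 0ρ(u), σ(10ρ(u), 110u) = σ(110u,
10ρ(u)) = 1ρ(u) and σ(111z, 111z) = 1z for every z; all other pairs go to the empty string. A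
preimage of 0z reveals some u with ρ(u) = z, so σ is noninvertible. If the value is 1z and the
argument 10z must be kept, the partner has to be 110u with ρ(u) = z, so σ is strongly noninvertible.
But overstrongness allows the given argument to be thrown away: an argument that occurs with the
value 0z is some 0u and can be doubled, and 1z always has the preimage (111z, 111z), whatever
argument is given. Hence σ is not overstrong.

The remaining work is to show that the functions involved run in polynomial time on `TM2` machines.
Small structured programs with five registers, which can call machines, are compiled into machines
(`Run.stepsIn`, `wrapper_outputs`). This yields closure under composition and pairing
(`PolyTime.comp`, `PolyTime.fork`) and a few explicit string functions, from which ρ, σ and the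
reductions are assembled. -/

namespace PolyOneWay

open Turing StateTransition

/-! ### Register programs with calls, and their running time -/

/-- The alphabet of the registers of a program. -/
abbrev Sym : Type := Option Bool

/-- A Turing machine together with translations between its alphabets and `Sym`. -/
structure Callee where
  /-- the machine -/
  tm : FinTM2
  /-- translation into the input alphabet -/
  dec : Sym → tm.Γ tm.k₀
  /-- translation from the output alphabet -/
  enc : tm.Γ tm.k₁ → Sym

/-- Structured programs over five registers which hold stacks of symbols. A program can call
machines with indices in `ι`. -/
inductive Prog (ι : Type) : Type
  | skip : Prog ι
  | push (k : Fin 5) (a : Sym) : Prog ι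
  | seq (p q : Prog ι) : Prog ι
  | loop (k : Fin 5) (body : Sym → Prog ι) : Prog ι
  | pop (k : Fin 5) (e : Prog ι) (body : Sym → Prog ι) : Prog ι
  | call (i : ι) (src dst : Fin 5) : Prog ι

/-- The contents of the registers. -/
abbrev Regs : Type := Fin 5 → List Sym

section Machine

variable {ι : Type} (M : ι → Callee)

/-- `Run M p r r' t`: the program `p` takes the registers from `r` to `r'` in at most `t` steps. -/
inductive Run : Prog ι → Regs → Regs → ℕ → Prop
  | skip (r) : Run .skip r r 1
  | push (k a r) : Run (.push k a) r (Function.update r k (a :: r k)) 1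
  | seq {p q r r' r'' t t'} : Run p r r' t → Run q r' r'' t' → Run (.seq p q) r r'' (t + t')
  | loop_nil {k body r} : r k = [] → Run (.loop k body) r r 1
  | loop_cons {k body r r' r'' a l t t'} : r k = a :: l →
      Run (body a) (Function.update r k l) r' t → Run (.loop k body) r' r'' t' →
      Run (.loop k body) r r'' (1 + t + t')
  | pop_nil {k e body r r' t} : r k = [] → Run e r r' t → Run (.pop k e body) r r' (1 + t)
  | pop_cons {k e body r r' a l t} : r k = a :: l →
      Run (body a) (Function.update r k l) r' t → Run (.pop k e body) r r' (1 + t)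
  | call {i src dst r} {u : List Sym} {o : List ((M i).tm.Γ (M i).tm.k₁)} {t : ℕ} :
      -- Moving a stack to another reverses it, so the source holds the input backwards and the
      -- destination receives the output backwards. Each transfer takes one extra step to notice
      -- that its stack is empty.
      r src = u.reverse →
      Nonempty (TM2OutputsInTime (M i).tm (u.map (M i).dec) (some o) t) →
      Run (.call i src dst) r (Function.update (Function.update r src []) dst
        ((o.map (M i).enc).reverse ++ Function.update r src [] dst))
        (u.length + 1 + t + (o.length + 1))
  | mono {p r r' t t'} : Run p r r' t → t ≤ t' → Run p r r' t'

/-! ### Compilation of programs into machine statements -/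

/-- The stacks of a machine that executes a program: an input stack, an output stack, the
registers and the stacks of the called machines. -/
inductive Tape : Type
  | inp : Tape
  | out : Tape
  | reg (k : Fin 5) : Tape
  | sub (i : ι) (k : (M i).tm.K) : Tape

noncomputable instance : DecidableEq (Tape M) := Classical.decEq _

instance [Fintype ι] : Finite (Tape M) := by
  have : ∀ i, Fintype (M i).tm.K := fun i => (M i).tm.kFin
  refine Finite.of_injective (β := Bool ⊕ Fin 5 ⊕ Σ i, (M i).tm.K)
    (fun x => match x with
      | .inp => .inl true
      | .out => .inl false
      | .reg k => .inr (.inl k)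
      | .sub i k => .inr (.inr ⟨i, k⟩)) ?_
  rintro (_ | _ | k | ⟨i, k⟩) (_ | _ | k' | ⟨i', k'⟩) h <;> simp_all

variable (Γ₀ Γ₁ : Type)

/-- The alphabets of the stacks. -/
abbrev TapeSym : Tape M → Type
  | .inp => Γ₀
  | .out => Γ₁
  | .reg _ => Sym
  | .sub i k => (M i).tm.Γ k

/-- The internal state: a buffer and the internal states of the called machines. -/
abbrev Mem : Type := Option Sym × ∀ i, (M i).tm.σ

/-- The stacks of the called machines. -/
abbrev SubStk : Type := ∀ (i : ι) (k : (M i).tm.K), List ((M i).tm.Γ k)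

variable {Γ₀ Γ₁}

/-- The contents of all the stacks. -/
def allStk (I : List Γ₀) (O : List Γ₁) (r : Regs) (S : SubStk M) :
    ∀ k, List (TapeSym M Γ₀ Γ₁ k)
  | .inp => I
  | .out => O
  | .reg k => r k
  | .sub i k => S i k

section
variable (I I' : List Γ₀) (O O' : List Γ₁) (r : Regs) (S : SubStk M)

@[simp] theorem allStk_inp : allStk M I O r S .inp = I := rfl
@[simp] theorem allStk_out : allStk M I O r S .out = O := rfl
@[simp] theorem allStk_reg (k : Fin 5) : allStk M I O r S (.reg k) = r k := rfl
@[simp] theorem allStk_sub (i : ι) (k : (M i).tm.K) : allStk M I O r S (.sub i k) = S i k := rfl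

@[simp] theorem update_inp :
    Function.update (allStk M I O r S) .inp I' = allStk M I' O r S := by
  funext k
  by_cases h : k = .inp
  · subst h; simp
  · rw [Function.update_of_ne h]; cases k <;> simp_all

@[simp] theorem update_out :
    Function.update (allStk M I O r S) .out O' = allStk M I O' r S := by
  funext k
  by_cases h : k = .out
  · subst h; simp
  · rw [Function.update_of_ne h]; cases k <;> simp_all

@[simp] theorem update_reg (k : Fin 5) (l : List Sym) :
    Function.update (allStk M I O r S) (.reg k) l
      = allStk M I O (Function.update r k l) S := by
  funext j
  by_cases h : j = .reg k
  · subst h; simp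
  · rw [Function.update_of_ne h]
    rcases j with _ | _ | j | ⟨i, j⟩ <;> simp_all [Function.update_of_ne]

@[simp] theorem update_sub [DecidableEq ι] (i : ι) (k : (M i).tm.K) (l : List ((M i).tm.Γ k)) :
    Function.update (allStk M I O r S) (.sub i k) l
      = allStk M I O r (Function.update S i (Function.update (S i) k l)) := by
  funext j
  by_cases h : j = .sub i k
  · subst h; simp
  · rw [Function.update_of_ne h]
    rcases j with _ | _ | j | ⟨i', j⟩
    · rfl
    · rfl
    · rfl
    · by_cases hi : i' = i
      · subst hi
        have : j ≠ k := fun e => h (by rw [e])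
        simp [Function.update_of_ne this]
      · simp [Function.update_of_ne hi]

end

/-- The labels that a program needs. -/
def Lab : Prog ι → Type
  | .skip => Unit
  | .push _ _ => Unit
  | .seq p q => Lab p ⊕ Lab q
  | .loop _ body => Unit ⊕ Σ a, Lab (body a)
  | .pop _ e body => Unit ⊕ Lab e ⊕ Σ a, Lab (body a)
  | .call i _ _ => Bool ⊕ (M i).tm.Λ

instance finite_lab : ∀ p : Prog ι, Finite (Lab M p)
  | .skip => inferInstanceAs (Finite Unit)
  | .push _ _ => inferInstanceAs (Finite Unit)
  | .seq p q => by
    have := finite_lab p; have := finite_lab q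
    exact inferInstanceAs (Finite (Lab M p ⊕ Lab M q))
  | .loop _ body => by
    have := fun a => finite_lab (body a)
    exact inferInstanceAs (Finite (Unit ⊕ Σ a, Lab M (body a)))
  | .pop _ e body => by
    have := finite_lab e; have := fun a => finite_lab (body a)
    exact inferInstanceAs (Finite (Unit ⊕ Lab M e ⊕ Σ a, Lab M (body a)))
  | .call i _ _ => by
    have := (M i).tm.ΛFin
    exact inferInstanceAs (Finite (Bool ⊕ (M i).tm.Λ))

/-- The label where the execution of a program starts. -/
def entry : ∀ p : Prog ι, Lab M p
  | .skip => ()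
  | .push _ _ => ()
  | .seq p _ => .inl (entry p)
  | .loop _ _ => .inl ()
  | .pop _ _ _ => .inl ()
  | .call _ _ _ => .inl true

variable [DecidableEq ι]

/-- The statements of a called machine as statements of the calling machine. -/
def liftStmt (i : ι) {Λ : Type} (emb : (M i).tm.Λ → Λ) (done : Λ) :
    TM2.Stmt (M i).tm.Γ (M i).tm.Λ (M i).tm.σ → TM2.Stmt (TapeSym M Γ₀ Γ₁) Λ (Mem M)
  | .push k f q => .push (.sub i k) (fun v => f (v.2 i)) (liftStmt i emb done q)
  | .peek k f q => .peek (.sub i k) (fun v o => (v.1, Function.update v.2 i (f (v.2 i) o)))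
      (liftStmt i emb done q)
  | .pop k f q => .pop (.sub i k) (fun v o => (v.1, Function.update v.2 i (f (v.2 i) o)))
      (liftStmt i emb done q)
  | .load f q => .load (fun v => (v.1, Function.update v.2 i (f (v.2 i)))) (liftStmt i emb done q)
  | .branch f q₁ q₂ => .branch (fun v => f (v.2 i)) (liftStmt i emb done q₁)
      (liftStmt i emb done q₂)
  | .goto f => .goto fun v => emb (f (v.2 i))
  | .halt => .goto fun _ => done

/-- The statements that execute a program and then go to the label `exit`. -/
def code {Λ : Type} : ∀ p : Prog ι, (Lab M p → Λ) → Λ → Lab M p →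
    TM2.Stmt (TapeSym M Γ₀ Γ₁) Λ (Mem M)
  | .skip, _, exit => fun _ => .goto fun _ => exit
  | .push k a, _, exit => fun _ => .push (.reg k) (fun _ => a) (.goto fun _ => exit)
  | .seq p q, emb, exit => Sum.elim
      (code p (fun l => emb (.inl l)) (emb (.inr (entry M q))))
      (code q (fun l => emb (.inr l)) exit)
  | .loop k body, emb, exit => Sum.elim
      (fun _ => .pop (.reg k) (fun v o => (o, v.2)) (.goto fun v =>
        v.1.elim exit fun a => emb (.inr ⟨a, entry M (body a)⟩)))
      (fun l => code (body l.1) (fun l' => emb (.inr ⟨l.1, l'⟩)) (emb (.inl ())) l.2)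
  | .pop k e body, emb, exit => Sum.elim
      (fun _ => .pop (.reg k) (fun v o => (o, v.2)) (.goto fun v =>
        v.1.elim (emb (.inr (.inl (entry M e)))) fun a =>
          emb (.inr (.inr ⟨a, entry M (body a)⟩))))
      (Sum.elim (code e (fun l => emb (.inr (.inl l))) exit)
        (fun l => code (body l.1) (fun l' => emb (.inr (.inr ⟨l.1, l'⟩))) exit l.2))
  | .call i src dst, emb, exit => Sum.elim
      -- The label `.inl true` moves `src` to the input stack of the called machine; the label `.inl
      -- false`, reached when that machine halts, moves its output stack to `dst`.
      (fun b => cond b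
        (.pop (.reg src) (fun v o => (o, v.2)) (.branch (fun v => v.1.isSome)
          (.push (.sub i (M i).tm.k₀) (fun v => (M i).dec (v.1.getD none))
            (.goto fun _ => emb (.inl true)))
          (.goto fun _ => emb (.inr (M i).tm.main))))
        (.pop (.sub i (M i).tm.k₁) (fun v o => (o.map (M i).enc, v.2))
          (.branch (fun v => v.1.isSome)
            (.push (.reg dst) (fun v => v.1.getD none) (.goto fun _ => emb (.inl false)))
            (.goto fun _ => exit))))
      (fun l => liftStmt M i (fun l' => emb (.inr l')) (emb (.inl false)) ((M i).tm.m l))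

/-! ### Correctness of the compilation -/

/-- Some number of steps, at most `n`, leads from `a` to `b`. -/
def StepsIn {C : Type} (f : C → Option C) (a b : C) (n : ℕ) : Prop :=
  Nonempty (EvalsToInTime f a (some b) n)

theorem StepsIn.refl {C : Type} (f : C → Option C) (a : C) : StepsIn f a a 0 :=
  ⟨EvalsToInTime.refl f a⟩

theorem StepsIn.single {C : Type} {f : C → Option C} {a b : C} (h : f a = some b) :
    StepsIn f a b 1 :=
  ⟨⟨⟨1, by simpa [flip] using h⟩, le_rfl⟩⟩

theorem StepsIn.trans {C : Type} {f : C → Option C} {a b c : C} {m n : ℕ}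
    (h : StepsIn f a b m) (h' : StepsIn f b c n) : StepsIn f a c (m + n) := by
  obtain ⟨h⟩ := h
  obtain ⟨h'⟩ := h'
  exact ⟨by simpa [add_comm] using EvalsToInTime.trans f m n a b _ h h'⟩

theorem StepsIn.mono {C : Type} {f : C → Option C} {a b : C} {m n : ℕ}
    (h : StepsIn f a b m) (hmn : m ≤ n) : StepsIn f a b n := by
  obtain ⟨h⟩ := h
  exact ⟨⟨h.toEvalsTo, h.steps_le_m.trans hmn⟩⟩

theorem iterate_flip_bind_none {C : Type} (f : C → Option C) (n : ℕ) :
    (flip bind f)^[n] none = none := by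
  induction n with
  | zero => rfl
  | succ n ih => rw [Function.iterate_succ_apply]; exact ih

/-- The idle states of the called machines. -/
def idleMem : ∀ i, (M i).tm.σ := fun i => (M i).tm.initialState

/-- The empty stacks of the called machines. -/
def idleStk : SubStk M := fun _ _ => []

section Call

variable {Λ : Type} (i : ι) (emb : (M i).tm.Λ → Λ) (done : Λ) (b : Option Sym)
  (I : List Γ₀) (O : List Γ₁) (r : Regs)

/-- A configuration of a called machine as a configuration of the calling machine. -/
def liftCfg (c : (M i).tm.Cfg) : TM2.Cfg (TapeSym M Γ₀ Γ₁) Λ (Mem M) :=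
  ⟨some (c.l.elim done emb), (b, Function.update (idleMem M) i c.var),
    allStk M I O r (Function.update (idleStk M) i c.stk)⟩

/-- A lifted statement touches only the stacks and the state with index `i`, and halting becomes a
jump to `done`, which is how `liftCfg` translates the missing label. -/
theorem stepAux_liftStmt (q : TM2.Stmt (M i).tm.Γ (M i).tm.Λ (M i).tm.σ) (v : (M i).tm.σ)
    (S : ∀ k, List ((M i).tm.Γ k)) :
    TM2.stepAux (liftStmt M i emb done q) (b, Function.update (idleMem M) i v)
      (allStk M I O r (Function.update (idleStk M) i S))
      = liftCfg M i emb done b I O r (TM2.stepAux q v S) := by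
  induction q generalizing v S with
  | push k f q ih => simp [liftStmt, ih]
  | peek k f q ih => simp [liftStmt, ih]
  | pop k f q ih => simp [liftStmt, ih]
  | load f q ih => simp [liftStmt, ih]
  | branch f q₁ q₂ ih₁ ih₂ =>
    simp only [liftStmt, TM2.stepAux, Function.update_self]
    cases f v <;> simp [ih₁, ih₂]
  | goto f => simp [liftStmt, liftCfg]
  | halt => simp [liftStmt, liftCfg]

/-- The simulation is step by step. A halted configuration has no successor, so halting can occur
only at the end of the run, and the translated halt at `done` never has to be continued. -/
theorem stepsIn_liftCfg (m : Λ → TM2.Stmt (TapeSym M Γ₀ Γ₁) Λ (Mem M))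
    (hm : ∀ l, m (emb l) = liftStmt M i emb done ((M i).tm.m l)) (n : ℕ) :
    ∀ c c' : (M i).tm.Cfg, (flip bind (M i).tm.step)^[n] (some c) = some c' →
    StepsIn (TM2.step m) (liftCfg M i emb done b I O r c) (liftCfg M i emb done b I O r c') n := by
  induction n with
  | zero =>
    intro c c' h
    cases h
    exact StepsIn.refl _ _
  | succ n ih =>
    rintro ⟨_ | l, v, S⟩ c' h
    · rw [Function.iterate_succ_apply] at h
      have : flip bind (M i).tm.step (some ⟨none, v, S⟩) = none := rfl
      rw [this, iterate_flip_bind_none] at h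
      cases h
    · rw [Function.iterate_succ_apply] at h
      have h1 := ih (TM2.stepAux ((M i).tm.m l) v S) c' h
      rw [add_comm]
      refine StepsIn.trans (StepsIn.single ?_) h1
      simp only [liftCfg, Option.elim_some, TM2.step, hm]
      rw [stepAux_liftStmt]
      rfl

end Call

theorem initList_eq (tm : FinTM2) (s : List (tm.Γ tm.k₀)) :
    initList tm s = ⟨some tm.main, tm.initialState, Function.update (fun _ => []) tm.k₀ s⟩ := by
  unfold initList
  congr 1
  funext k
  by_cases h : k = tm.k₀
  · subst h; simp
  · simp [h]

theorem haltList_eq (tm : FinTM2) (s : List (tm.Γ tm.k₁)) :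
    haltList tm s = ⟨none, tm.initialState, Function.update (fun _ => []) tm.k₁ s⟩ := by
  unfold haltList
  congr 1
  funext k
  by_cases h : k = tm.k₁
  · subst h; simp
  · simp [h]

theorem update_idleStk (i : ι) : Function.update (idleStk M) i (fun _ => []) = idleStk M := by
  rw [Function.update_eq_self_iff]; rfl

theorem update_idleMem (i : ι) :
    Function.update (idleMem M) i (M i).tm.initialState = idleMem M := by
  rw [Function.update_eq_self_iff]; rfl

variable {M}

/-- The statements of a program execute it. -/
theorem Run.stepsIn {Λ : Type} {m : Λ → TM2.Stmt (TapeSym M Γ₀ Γ₁) Λ (Mem M)}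
    (I : List Γ₀) (O : List Γ₁) {p : Prog ι} {r r' : Regs} {t : ℕ} (h : Run M p r r' t) :
    ∀ (emb : Lab M p → Λ) (exit : Λ), (∀ l, m (emb l) = code M p emb exit l) →
    ∀ b, ∃ b', StepsIn (TM2.step m)
      ⟨some (emb (entry M p)), (b, idleMem M), allStk M I O r (idleStk M)⟩
      ⟨some exit, (b', idleMem M), allStk M I O r' (idleStk M)⟩ t := by
  induction h with
  | skip r =>
    intro emb exit hm b
    exact ⟨b, StepsIn.single (by simp [TM2.step, hm, code])⟩
  | push k a r =>
    intro emb exit hm b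
    exact ⟨b, StepsIn.single (by simp [TM2.step, hm, code])⟩
  | @seq p q r r' r'' t t' _ _ ih₁ ih₂ =>
    intro emb exit hm b
    obtain ⟨b₁, h₁⟩ := ih₁ (fun l => emb (.inl l)) (emb (.inr (entry M q)))
      (fun l => hm (.inl l)) b
    obtain ⟨b₂, h₂⟩ := ih₂ (fun l => emb (.inr l)) exit (fun l => hm (.inr l)) b₁
    exact ⟨b₂, h₁.trans h₂⟩
  | @loop_nil k body r hk =>
    intro emb exit hm b
    refine ⟨none, StepsIn.single ?_⟩
    have e : Function.update r k [] = r := by rw [← hk, Function.update_eq_self]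
    simp only [TM2.step, hm]
    simp [code, entry, hk, e]
  | @loop_cons k body r r' r'' a l t t' hk _ _ ih₁ ih₂ =>
    intro emb exit hm b
    obtain ⟨b₁, h₁⟩ := ih₁ (fun l => emb (.inr ⟨a, l⟩)) (emb (.inl ()))
      (fun l => hm (.inr ⟨a, l⟩)) (some a)
    obtain ⟨b₂, h₂⟩ := ih₂ emb exit hm b₁
    refine ⟨b₂, ((StepsIn.single ?_).trans h₁).trans h₂⟩
    simp only [TM2.step, hm]
    simp [code, entry, hk]
  | @pop_nil k e body r r' t hk _ ih =>
    intro emb exit hm b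
    obtain ⟨b₁, h₁⟩ := ih (fun l => emb (.inr (.inl l))) exit
      (fun l => hm (.inr (.inl l))) none
    refine ⟨b₁, (StepsIn.single ?_).trans h₁⟩
    have e : Function.update r k [] = r := by rw [← hk, Function.update_eq_self]
    simp only [TM2.step, hm]
    simp [code, entry, hk, e]
  | @pop_cons k e body r r' a l t hk _ ih =>
    intro emb exit hm b
    obtain ⟨b₁, h₁⟩ := ih (fun l => emb (.inr (.inr ⟨a, l⟩))) exit
      (fun l => hm (.inr (.inr ⟨a, l⟩))) (some a)
    refine ⟨b₁, (StepsIn.single ?_).trans h₁⟩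
    simp only [TM2.step, hm]
    simp [code, entry, hk]
  | @call i src dst r u o t hsrc ho =>
    intro emb exit hm b
    obtain ⟨ho⟩ := ho
    have hT := hm (.inl true)
    have hF := hm (.inl false)
    simp only [code, Sum.elim_inl, cond_true, cond_false] at hT hF
    have load : ∀ (w : List Sym) (l : List ((M i).tm.Γ (M i).tm.k₀)) (r : Regs) (b : Option Sym),
        r src = w → StepsIn (TM2.step m)
          ⟨some (emb (.inl true)), (b, idleMem M), allStk M I O r
            (Function.update (idleStk M) i (Function.update (fun _ => []) (M i).tm.k₀ l))⟩
          ⟨some (emb (.inr (M i).tm.main)), (none, idleMem M), allStk M I O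
            (Function.update r src []) (Function.update (idleStk M) i
              (Function.update (fun _ => []) (M i).tm.k₀ (w.reverse.map (M i).dec ++ l)))⟩
          (w.length + 1) := by
      intro w
      induction w with
      | nil =>
        intro l r b hr
        refine StepsIn.single ?_
        simp [TM2.step, hT, hr]
      | cons a w ih =>
        intro l r b hr
        have h := ih ((M i).dec a :: l) (Function.update r src w) (some a) (by simp)
        have e : (a :: w).length + 1 = 1 + (w.length + 1) := by simp; omega
        rw [e]
        refine StepsIn.trans (StepsIn.single ?_) (by simpa using h)
        simp [TM2.step, hT, hr]
    have unload : ∀ (w : List ((M i).tm.Γ (M i).tm.k₁)) (r : Regs) (b : Option Sym),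
        StepsIn (TM2.step m)
          ⟨some (emb (.inl false)), (b, idleMem M), allStk M I O r
            (Function.update (idleStk M) i (Function.update (fun _ => []) (M i).tm.k₁ w))⟩
          ⟨some exit, (none, idleMem M), allStk M I O
            (Function.update r dst ((w.map (M i).enc).reverse ++ r dst)) (idleStk M)⟩
          (w.length + 1) := by
      intro w
      induction w with
      | nil =>
        intro r b
        refine StepsIn.single ?_
        have e : ∀ k, idleStk M i k = [] := fun _ => rfl
        have e' : Function.update (idleStk M i) (M i).tm.k₁ [] = fun _ => [] := by
          rw [Function.update_eq_iff]; exact ⟨rfl, fun _ _ => rfl⟩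
        simp [TM2.step, hF, e, e', update_idleStk]
      | cons a w ih =>
        intro r b
        have h := ih (Function.update r dst ((M i).enc a :: r dst)) (some ((M i).enc a))
        have e : (a :: w).length + 1 = 1 + (w.length + 1) := by simp; omega
        rw [e]
        refine StepsIn.trans (StepsIn.single ?_) (by simpa using h)
        simp [TM2.step, hF]
    have h₁ := load u.reverse [] r b hsrc
    have e : Function.update (fun _ => []) (M i).tm.k₀ []
        = (fun k => [] : ∀ k, List ((M i).tm.Γ k)) := by
      rw [Function.update_eq_self_iff]
    rw [e, update_idleStk, List.append_nil, List.reverse_reverse, List.length_reverse] at h₁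
    have h₂ := (stepsIn_liftCfg M i (fun l => emb (.inr l)) (emb (.inl false)) none I O
      (Function.update r src []) m (fun l => hm (.inr l)) ho.steps _ _ ho.evals_in_steps).mono
      ho.steps_le_m
    -- A machine that halts with its output is back in its initial state, with all stacks but the
    -- output stack empty. After unloading it is idle again, so it can be called any number of
    -- times.
    rw [initList_eq, haltList_eq] at h₂
    simp only [liftCfg, Option.elim_some, Option.elim_none, update_idleMem] at h₂
    exact ⟨none, (h₁.trans h₂).trans (unload o (Function.update r src []) none)⟩
  | mono _ hle ih =>
    intro emb exit hm b
    obtain ⟨b', h'⟩ := ih emb exit hm b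
    exact ⟨b', h'.mono hle⟩

end Machine

/-! ### Machines with input and output stacks around a program -/

/-- An alphabet that is embedded into `Sym`. -/
class SymCode (Γ : Type) extends Fintype Γ where
  /-- the embedding -/
  toSym : Γ → Sym
  /-- a left inverse of the embedding -/
  ofSym : Sym → Γ
  ofSym_toSym : ∀ a, ofSym (toSym a) = a

attribute [simp] SymCode.ofSym_toSym

open SymCode

instance : SymCode Bool where
  toSym := some
  ofSym a := a.getD false
  ofSym_toSym _ := rfl

instance : SymCode (Option Bool) where
  toSym := id
  ofSym := id
  ofSym_toSym _ := rfl

/-- A word over an alphabet as a word over `Sym`. -/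
def symWord {Γ : Type} [SymCode Γ] (u : List Γ) : List Sym := u.map toSym

@[simp] theorem length_symWord {Γ : Type} [SymCode Γ] (u : List Γ) :
    (symWord u).length = u.length := List.length_map ..

@[simp] theorem symWord_option (u : List (Option Bool)) : symWord u = u := List.map_id u

theorem symWord_bool (u : List Bool) : symWord u = u.map some := rfl

/-- The register contents with one non-empty register. -/
def single (k : Fin 5) (u : List Sym) : Regs := Function.update (fun _ => []) k u

section Wrapper

variable {ι : Type} [Fintype ι] [DecidableEq ι] (M : ι → Callee)
  (Γ₀ Γ₁ : Type) [SymCode Γ₀] [SymCode Γ₁] (p : Prog ι)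

/-- The statements of the machine that moves its input to register `0`, executes a program, and
moves register `1` to its output. -/
noncomputable def wrapperCode : Bool ⊕ Lab M p →
    TM2.Stmt (TapeSym M Γ₀ Γ₁) (Bool ⊕ Lab M p) (Mem M)
  | .inl true => .pop .inp (fun v o => (o.map toSym, v.2)) (.branch (fun v => v.1.isSome)
      (.push (.reg 0) (fun v => v.1.getD none) (.goto fun _ => .inl true))
      (.goto fun _ => .inr (entry M p)))
  | .inl false => .pop (.reg 1) (fun v o => (o, v.2)) (.branch (fun v => v.1.isSome)
      (.push .out (fun v => ofSym (v.1.getD none)) (.goto fun _ => .inl false))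
      .halt)
  | .inr l => code M p .inr (.inl false) l

/-- The machine that executes a program. -/
noncomputable def wrapper : FinTM2 where
  K := Tape M
  kFin := Fintype.ofFinite _
  k₀ := .inp
  k₁ := .out
  Γ := TapeSym M Γ₀ Γ₁
  Λ := Bool ⊕ Lab M p
  main := .inl true
  ΛFin := Fintype.ofFinite _
  σ := Mem M
  initialState := (none, idleMem M)
  σFin := by
    have : ∀ i, Fintype (M i).tm.σ := fun i => (M i).tm.σFin
    exact inferInstanceAs (Fintype (Option Sym × ∀ i, (M i).tm.σ))
  Γk₀Fin := inferInstanceAs (Fintype Γ₀)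
  m := wrapperCode M Γ₀ Γ₁ p

variable {M Γ₀ Γ₁ p}

/-- Popping the input into register `0` reverses it, and so does popping register `1` into the
output; this explains the reversals in the hypothesis. The two extra steps find the input stack and
register `1` empty. -/
theorem wrapper_outputs (u : List Γ₀) (w : List Γ₁) (t : ℕ)
    (h : Run M p (single 0 (symWord u).reverse) (single 1 (symWord w).reverse) t) :
    Nonempty (TM2OutputsInTime (wrapper M Γ₀ Γ₁ p) u (some w) (u.length + t + w.length + 2)) := by
  have load : ∀ (u : List Γ₀) (v : List Sym) (b : Option Sym),
      StepsIn (TM2.step (wrapperCode M Γ₀ Γ₁ p))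
        ⟨some (.inl true), (b, idleMem M), allStk M u [] (single 0 v) (idleStk M)⟩
        ⟨some (.inr (entry M p)), (none, idleMem M),
          allStk M [] [] (single 0 ((symWord u).reverse ++ v)) (idleStk M)⟩ (u.length + 1) := by
    intro u
    induction u with
    | nil =>
      intro v b
      exact StepsIn.single (by simp [TM2.step, wrapperCode, symWord])
    | cons a u ih =>
      intro v b
      have h := ih (toSym a :: v) (some (toSym a))
      have e : (a :: u).length + 1 = 1 + (u.length + 1) := by simp; omega
      rw [e]
      refine StepsIn.trans (StepsIn.single ?_) (by simpa [symWord] using h)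
      simp [TM2.step, wrapperCode, single]
  have unload : ∀ (w : List Sym) (v : List Γ₁) (b : Option Sym),
      StepsIn (TM2.step (wrapperCode M Γ₀ Γ₁ p))
        ⟨some (.inl false), (b, idleMem M), allStk M [] v (single 1 w) (idleStk M)⟩
        ⟨none, (none, idleMem M),
          allStk M [] (w.reverse.map ofSym ++ v) (fun _ => []) (idleStk M)⟩
        (w.length + 1) := by
    intro w
    induction w with
    | nil =>
      intro v b
      exact StepsIn.single (by simp [TM2.step, wrapperCode, single])
    | cons a w ih =>
      intro v b
      have h := ih (ofSym a :: v) (some a)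
      have e : (a :: w).length + 1 = 1 + (w.length + 1) := by simp; omega
      rw [e]
      refine StepsIn.trans (StepsIn.single ?_) (by simpa using h)
      simp [TM2.step, wrapperCode, single]
  have h₁ := load u [] none
  rw [List.append_nil] at h₁
  obtain ⟨b, h₂⟩ := h.stepsIn [] [] (m := wrapperCode M Γ₀ Γ₁ p) .inr (.inl false)
    (fun l => rfl) none
  have h₃ := unload (symWord w).reverse [] b
  have e : (symWord w).reverse.reverse.map ofSym ++ [] = w := by
    simp [symWord, Function.comp_def]
  rw [e] at h₃
  have h₄ := ((h₁.trans h₂).trans h₃).mono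
    (n := u.length + t + w.length + 2) (by simp; omega)
  have hi : initList (wrapper M Γ₀ Γ₁ p) u = ⟨some (.inl true), (none, idleMem M),
      allStk M u [] (single 0 []) (idleStk M)⟩ := by
    refine (initList_eq (wrapper M Γ₀ Γ₁ p) u).trans ?_
    have : Function.update (fun _ => [] : ∀ k, List (TapeSym M Γ₀ Γ₁ k)) Tape.inp u
        = allStk M u ([] : List Γ₁) (single 0 []) (idleStk M) := by
      rw [← update_inp M ([] : List Γ₀)]
      congr 1
      funext k
      cases k <;> simp [single, idleStk]
    exact congrArg _ this
  have ho : haltList (wrapper M Γ₀ Γ₁ p) w = ⟨none, (none, idleMem M),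
      allStk M [] w (fun _ => []) (idleStk M)⟩ := by
    refine (haltList_eq (wrapper M Γ₀ Γ₁ p) w).trans ?_
    have : Function.update (fun _ => [] : ∀ k, List (TapeSym M Γ₀ Γ₁ k)) Tape.out w
        = allStk M ([] : List Γ₀) w (fun _ => []) (idleStk M) := by
      rw [← update_out M _ ([] : List Γ₁)]
      congr 1
      funext k
      cases k <;> simp [idleStk]
    exact congrArg _ this
  exact (congrArg₂ (fun a b => StepsIn (TM2.step (wrapperCode M Γ₀ Γ₁ p)) a b
    (u.length + t + w.length + 2)) hi ho).mpr h₄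

end Wrapper

/-! ### Polynomial bounds, and machines from programs -/

/-- A function that is bounded by a polynomial. -/
def PolyBdd (t : ℕ → ℕ) : Prop := ∃ q : Polynomial ℕ, ∀ n, t n ≤ q.eval n

theorem PolyBdd.const (c : ℕ) : PolyBdd fun _ => c := ⟨.C c, fun n => by simp⟩

theorem PolyBdd.id : PolyBdd fun n => n := ⟨.X, fun n => by simp⟩

theorem PolyBdd.eval (q : Polynomial ℕ) : PolyBdd fun n => q.eval n := ⟨q, fun _ => le_rfl⟩

theorem PolyBdd.add {s t : ℕ → ℕ} (hs : PolyBdd s) (ht : PolyBdd t) :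
    PolyBdd fun n => s n + t n := by
  obtain ⟨q, hq⟩ := hs
  obtain ⟨q', hq'⟩ := ht
  exact ⟨q + q', fun n => by simpa using Nat.add_le_add (hq n) (hq' n)⟩

theorem PolyBdd.mul {s t : ℕ → ℕ} (hs : PolyBdd s) (ht : PolyBdd t) :
    PolyBdd fun n => s n * t n := by
  obtain ⟨q, hq⟩ := hs
  obtain ⟨q', hq'⟩ := ht
  exact ⟨q * q', fun n => by simpa using Nat.mul_le_mul (hq n) (hq' n)⟩

/-- The coefficients are natural numbers, so every monomial is monotone. -/
theorem eval_mono (q : Polynomial ℕ) {m n : ℕ} (h : m ≤ n) : q.eval m ≤ q.eval n := by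
  simp only [Polynomial.eval_eq_sum, Polynomial.sum]
  gcongr

theorem PolyBdd.eval_comp (q : Polynomial ℕ) {t : ℕ → ℕ} (ht : PolyBdd t) :
    PolyBdd fun n => q.eval (t n) := by
  obtain ⟨q', hq'⟩ := ht
  exact ⟨q.comp q', fun n => by simpa using eval_mono q (hq' n)⟩

/-- A program that computes a function in polynomial time yields a machine that does so. -/
theorem polyTime_of_run {ι : Type} [Fintype ι] [DecidableEq ι] {M : ι → Callee} (p : Prog ι)
    {α β Γ Δ : Type} [SymCode Γ] [SymCode Δ] {ea : α → List Γ} {eb : β → List Δ} {f : α → β}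
    {t : ℕ → ℕ} (ht : PolyBdd t) (hlen : ∀ x, (eb (f x)).length ≤ t (ea x).length)
    (h : ∀ x, Run M p (single 0 (symWord (ea x)).reverse) (single 1 (symWord (eb (f x))).reverse)
      (t (ea x).length)) :
    PolyTime ea eb f := by
  -- The summands pay for reading the input, for the program, for writing an output of length at
  -- most `t n`, and for the two tests for emptiness.
  obtain ⟨q, hq⟩ : PolyBdd fun n => n + t n + t n + 2 :=
    ((PolyBdd.id.add ht).add ht).add (.const 2)
  beta_reduce at hq
  refine ⟨{ tm := wrapper M Γ Δ p, inputAlphabet := Equiv.refl _, outputAlphabet := Equiv.refl _,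
            time := q, outputsFun := fun x => Classical.choice ?_ }⟩
  obtain ⟨ho⟩ := wrapper_outputs (ea x) (eb (f x)) _ (h x)
  have e₁ : List.map (Equiv.refl Γ).invFun (ea x) = ea x := List.map_id _
  have e₂ : List.map (Equiv.refl Δ).invFun (eb (f x)) = eb (f x) := List.map_id _
  refine ⟨⟨⟨ho.steps, ?_⟩, ho.steps_le_m.trans (le_trans ?_ (hq _))⟩⟩
  · have := ho.evals_in_steps
    refine Eq.trans ?_ (this.trans ?_)
    · exact congrArg (fun l => (flip bind (wrapper M Γ Δ p).step)^[ho.steps]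
        (some (initList (wrapper M Γ Δ p) l))) e₁
    · exact congrArg (fun l => Option.map (haltList (wrapper M Γ Δ p)) (some l)) e₂.symm
  · have := hlen x
    omega

/-! ### Output length, and machines as callees -/

section OutputLength

variable {K : Type} [DecidableEq K] {Γ : K → Type} {Λ σ : Type}

/-- A bound for the number of symbols that a statement pushes. -/
def pushes : TM2.Stmt Γ Λ σ → ℕ
  | .push _ _ q => pushes q + 1
  | .peek _ _ q => pushes q
  | .pop _ _ q => pushes q
  | .load _ q => pushes q
  | .branch _ q₁ q₂ => pushes q₁ + pushes q₂
  | .goto _ => 0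
  | .halt => 0

theorem length_stepAux_le (q : TM2.Stmt Γ Λ σ) (v : σ) (S : ∀ k, List (Γ k)) (n : ℕ)
    (hS : ∀ k, (S k).length ≤ n) (k : K) :
    ((TM2.stepAux q v S).stk k).length ≤ n + pushes q := by
  induction q generalizing v S n with
  | push j f q ih =>
    rw [pushes, add_comm (pushes q), ← add_assoc]
    refine ih _ _ _ fun k => ?_
    by_cases h : k = j
    · subst h; simpa using hS k
    · rw [Function.update_of_ne h]; exact (hS k).trans (Nat.le_succ n)
  | peek j f q ih => exact ih _ _ _ hS
  | pop j f q ih =>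
    refine ih _ _ _ fun k => ?_
    by_cases h : k = j
    · subst h
      have := hS k
      simp only [Function.update_self, List.length_tail]; omega
    · rw [Function.update_of_ne h]; exact hS k
  | load f q ih => exact ih _ _ _ hS
  | branch f q₁ q₂ ih₁ ih₂ =>
    have h₁ := ih₁ v S n hS
    have h₂ := ih₂ v S n hS
    simp only [TM2.stepAux, pushes]
    cases f v
    · simp only [cond_false]; omega
    · simp only [cond_true]; omega
  | goto f => exact hS k
  | halt => exact hS k

/-- `PolyTime` bounds only the running time. Since a step pushes a bounded number of symbols, the
output length is polynomially bounded too, which composition requires. -/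
theorem length_iterate_step_le (m : Λ → TM2.Stmt Γ Λ σ) (c : ℕ) (hc : ∀ l, pushes (m l) ≤ c)
    (s : ℕ) : ∀ (a b : TM2.Cfg Γ Λ σ) (n : ℕ), (∀ k, (a.stk k).length ≤ n) →
      (flip bind (TM2.step m))^[s] (some a) = some b → ∀ k, (b.stk k).length ≤ n + c * s := by
  induction s with
  | zero =>
    intro a b n ha h k
    cases h
    exact (ha k).trans (Nat.le_add_right _ _)
  | succ s ih =>
    rintro ⟨_ | l, v, S⟩ b n ha h k
    · rw [Function.iterate_succ_apply] at h
      have e : flip bind (TM2.step m) (some ⟨none, v, S⟩) = none := rfl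
      rw [e, iterate_flip_bind_none] at h
      cases h
    · rw [Function.iterate_succ_apply] at h
      have := ih (TM2.stepAux (m l) v S) b (n + c)
        (fun k => (length_stepAux_le (m l) v S n ha k).trans (Nat.add_le_add_left (hc l) n)) h k
      rw [Nat.mul_succ]
      omega

end OutputLength

/-- A machine for a polynomial-time function, as a callee of programs. -/
theorem PolyTime.exists_callee {α β Γ Δ : Type} [SymCode Γ] [SymCode Δ] {ea : α → List Γ}
    {eb : β → List Δ} {f : α → β} (h : PolyTime ea eb f) :
    ∃ (c : Callee) (t : Polynomial ℕ), ∀ {ι : Type} (M : ι → Callee) (i : ι), M i = c →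
      ∀ x, (eb (f x)).length ≤ t.eval (ea x).length ∧
      ∀ (r : Regs) (src dst : Fin 5), r src = (symWord (ea x)).reverse →
        Run M (.call i src dst) r (Function.update (Function.update r src []) dst
          ((symWord (eb (f x))).reverse ++ Function.update r src [] dst))
          (t.eval (ea x).length) := by
  obtain ⟨h⟩ := h
  have := h.tm.ΛFin
  -- Loading, running and unloading. The sum of `pushes` over all labels bounds what a single step
  -- pushes, so the second bracket bounds the output length plus one.
  obtain ⟨q, hq⟩ : PolyBdd fun n => n + 1 + h.time.eval n
      + (n + (Finset.univ.sum fun l => pushes (h.tm.m l)) * h.time.eval n + 1) :=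
    (((PolyBdd.id.add (.const 1)).add (.eval _)).add
      ((PolyBdd.id.add ((PolyBdd.const _).mul (.eval _))).add (.const 1)))
  beta_reduce at hq
  have hlen : ∀ x, (eb (f x)).length ≤ (ea x).length +
      (Finset.univ.sum fun l => pushes (h.tm.m l)) * h.time.eval (ea x).length := by
    intro x
    have ho := h.outputsFun x
    have := length_iterate_step_le h.tm.m (Finset.univ.sum fun l => pushes (h.tm.m l))
      (fun l => Finset.single_le_sum (f := fun l => pushes (h.tm.m l))
        (fun _ _ => Nat.zero_le _) (Finset.mem_univ l))
      ho.steps _ _ (ea x).length (fun k => ?_) ho.evals_in_steps h.tm.k₁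
    · rw [haltList_eq] at this
      simp only [Function.update_self, List.length_map] at this
      exact this.trans (Nat.add_le_add_left (Nat.mul_le_mul_left _ ho.steps_le_m) _)
    · rw [initList_eq]
      by_cases hk : k = h.tm.k₀
      · subst hk; simp
      · simp [hk]
  obtain ⟨c, hc⟩ : ∃ c : Callee, ∀ x, ∃ o : List (c.tm.Γ c.tm.k₁),
      o.map c.enc = symWord (eb (f x)) ∧
      Nonempty (TM2OutputsInTime c.tm ((symWord (ea x)).map c.dec) (some o)
        (h.time.eval (ea x).length)) := by
    refine ⟨⟨h.tm, fun a => h.inputAlphabet.symm (ofSym a), fun a => toSym (h.outputAlphabet a)⟩,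
      fun x => ⟨(eb (f x)).map h.outputAlphabet.invFun, ?_, ?_⟩⟩
    · simp [symWord, Function.comp_def]
    · have e : (symWord (ea x)).map (fun a => h.inputAlphabet.symm (ofSym a))
          = (ea x).map h.inputAlphabet.invFun := by
        simp [symWord, Function.comp_def]
      exact ⟨e ▸ h.outputsFun x⟩
  refine ⟨c, q, ?_⟩
  intro ι M i hi x
  refine ⟨(hlen x).trans (le_trans (by omega) (hq _)), ?_⟩
  intro r src dst hr
  subst hi
  obtain ⟨o, ho, hrun⟩ := hc x
  have := Run.call (dst := dst) hr hrun
  rw [ho] at this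
  refine this.mono (le_trans ?_ (hq _))
  have h₁ := hlen x
  have h₂ : o.length = (eb (f x)).length := by
    rw [← List.length_map, ho, length_symWord]
  rw [length_symWord]
  omega

/-! ### Register bookkeeping, composition and pairing -/

section Regs

variable {α : Type} (a b c d e l : α)

@[simp] theorem update_vec_zero :
    Function.update ![a, b, c, d, e] 0 l = ![l, b, c, d, e] := by
  ext i; fin_cases i <;> rfl

@[simp] theorem update_vec_one :
    Function.update ![a, b, c, d, e] 1 l = ![a, l, c, d, e] := by
  ext i; fin_cases i <;> rfl

@[simp] theorem update_vec_two :
    Function.update ![a, b, c, d, e] 2 l = ![a, b, l, d, e] := by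
  ext i; fin_cases i <;> rfl

@[simp] theorem update_vec_three :
    Function.update ![a, b, c, d, e] 3 l = ![a, b, c, l, e] := by
  ext i; fin_cases i <;> rfl

@[simp] theorem update_vec_four :
    Function.update ![a, b, c, d, e] 4 l = ![a, b, c, d, l] := by
  ext i; fin_cases i <;> rfl

end Regs

theorem single_zero (u : List Sym) : single 0 u = ![u, [], [], [], []] := by
  ext i; fin_cases i <;> rfl

theorem single_one (u : List Sym) : single 1 u = ![[], u, [], [], []] := by
  ext i; fin_cases i <;> rfl

section Programs

variable {ι : Type} {M : ι → Callee}

theorem Run.of_eq {p : Prog ι} {r₀ r r' r'' : Regs} {t t' : ℕ} (h : Run M p r r' t) (e₀ : r₀ = r)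
    (e : r' = r'') (ht : t ≤ t') : Run M p r₀ r'' t' := by
  subst e₀ e
  exact h.mono ht

/-- The program that moves the contents of the register `k` to the register `j`, in reverse. -/
def Prog.move (k j : Fin 5) : Prog ι := .loop k fun a => .push j a

/-- The program that empties the register `k`. -/
def Prog.clear (k : Fin 5) : Prog ι := .loop k fun _ => .skip

theorem run_clear (k : Fin 5) (l : List Sym) : ∀ r : Regs, r k = l →
    Run M (.clear k) r (Function.update r k []) (2 * l.length + 1) := by
  induction l with
  | nil =>
    intro r h
    exact (Run.loop_nil h).of_eq rfl (by rw [← h, Function.update_eq_self]) (by simp)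
  | cons a l ih =>
    intro r h
    refine (Run.loop_cons h (Run.skip _) (ih (Function.update r k l) (by simp))).of_eq rfl
      (by simp) ?_
    simp only [List.length_cons]; omega

theorem run_move {k j : Fin 5} (hkj : j ≠ k) (l : List Sym) : ∀ r : Regs, r k = l →
    Run M (.move k j) r (Function.update (Function.update r k []) j (l.reverse ++ r j))
      (2 * l.length + 1) := by
  induction l with
  | nil =>
    intro r h
    exact (Run.loop_nil h).of_eq rfl (by
      rw [show Function.update r k [] = r by rw [← h, Function.update_eq_self]]; simp) (by simp)
  | cons a l ih =>
    intro r h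
    refine (Run.loop_cons h (Run.push j a _) (ih _ ?_)).of_eq rfl ?_ ?_
    · rw [Function.update_of_ne hkj.symm, Function.update_self]
    · funext i
      by_cases hi : i = j
      · subst hi; simp [Function.update_of_ne hkj]
      · by_cases hi' : i = k
        · subst hi'; simp [Function.update_of_ne hi]
        · simp [Function.update_of_ne hi, Function.update_of_ne hi']
    · simp only [List.length_cons]; omega

end Programs

/-- A program that computes a function in polynomial time, with its input in register `2` and the
reverse of its output in register `1`, yields a machine. -/
theorem polyTime_of_run_two {ι : Type} [Fintype ι] [DecidableEq ι] {M : ι → Callee} (p : Prog ι)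
    {α β Γ Δ : Type} [SymCode Γ] [SymCode Δ] {ea : α → List Γ} {eb : β → List Δ} {f : α → β}
    {t : ℕ → ℕ} (ht : PolyBdd t) (hlen : ∀ x, (eb (f x)).length ≤ t (ea x).length)
    (h : ∀ x, Run M p ![[], [], symWord (ea x), [], []]
      ![[], (symWord (eb (f x))).reverse, [], [], []] (t (ea x).length)) :
    PolyTime ea eb f := by
  refine polyTime_of_run (M := M) (.seq (.move 0 2) p) (t := fun n => 2 * n + 1 + t n)
    ((((PolyBdd.const 2).mul .id).add (.const 1)).add ht) (fun x => ?_) (fun x => ?_)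
  · have := hlen x
    omega
  · rw [single_zero, single_one]
    refine .seq ((run_move (by decide) (symWord (ea x)).reverse _ rfl).of_eq rfl ?_ ?_) (h x)
    · simp
    · simp

section Closure

variable {α β γ Γ Δ E : Type} [SymCode Γ] [SymCode Δ] [SymCode E] {ea : α → List Γ}
  {eb : β → List Δ} {ec : γ → List E}

/-- The first call leaves its output reversed in register `1`, just as the second call expects its
input. The length bound for the intermediate result and monotonicity bound the second running time.
-/
theorem PolyTime.comp {f : α → β} {g : β → γ} (hg : PolyTime eb ec g) (hf : PolyTime ea eb f) :
    PolyTime ea ec (fun x => g (f x)) := by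
  obtain ⟨cf, tf, hf⟩ := hf.exists_callee
  obtain ⟨cg, tg, hg⟩ := hg.exists_callee
  let M : Bool → Callee := fun b => cond b cg cf
  refine polyTime_of_run (M := M) (.seq (.call false 0 1) (.call true 1 1))
    (t := fun n => tf.eval n + tg.eval (tf.eval n)) ((PolyBdd.eval tf).add
      (.eval_comp tg (.eval tf))) (fun x => ?_) (fun x => ?_)
  · have h₁ := (hf M false rfl x).1
    have h₂ := (hg M true rfl (f x)).1
    have h₃ := eval_mono tg h₁
    omega
  · have h₁ := (hf M false rfl x).1
    rw [single_zero, single_one]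
    refine .seq (((hf M false rfl x).2 _ 0 1 rfl).of_eq rfl (r'' := ![[],
      (symWord (eb (f x))).reverse, [], [], []]) (by simp) le_rfl)
      (((hg M true rfl (f x)).2 _ 1 1 rfl).of_eq rfl (by simp) (eval_mono tg h₁))

/-- A call consumes its input, so the input is first copied to registers `0` and `3`. Both outputs
go on top of register `1`, with the separator pushed between the calls. -/
theorem PolyTime.fork {f g : α → Str} (hf : PolyTime ea encStr f) (hg : PolyTime ea encStr g) :
    PolyTime ea encPair (fun x => (f x, g x)) := by
  obtain ⟨cf, tf, hf⟩ := hf.exists_callee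
  obtain ⟨cg, tg, hg⟩ := hg.exists_callee
  let M : Bool → Callee := fun b => cond b cg cf
  have copy : ∀ u v w : List Sym, Run M (.loop 2 fun a => .seq (.push 0 a) (.push 3 a))
      ![v, [], u, w, []] ![u.reverse ++ v, [], [], u.reverse ++ w, []] (3 * u.length + 1) := by
    intro u
    induction u with
    | nil => intro v w; exact .loop_nil rfl
    | cons a u ih =>
      intro v w
      refine (Run.loop_cons (l := u) rfl (.seq (.push _ _ _) (.push _ _ _))
        ((ih (a :: v) (a :: w)).of_eq ?_ rfl le_rfl)).of_eq rfl ?_ ?_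
      · simp
      · simp
      · simp only [List.length_cons]; omega
  refine polyTime_of_run_two (M := M) (.seq (.loop 2 fun a => .seq (.push 0 a) (.push 3 a))
    (.seq (.call false 0 1) (.seq (.push 1 none) (.call true 3 1))))
    (t := fun n => 3 * n + 1 + (tf.eval n + (1 + tg.eval n))) ((((PolyBdd.const 3).mul .id).add
      (.const 1)).add ((PolyBdd.eval tf).add ((PolyBdd.const 1).add (.eval tg))))
    (fun x => ?_) (fun x => ?_)
  · have h₁ := (hf M false rfl x).1
    have h₂ := (hg M true rfl x).1
    simp only [encPair, List.length_append, List.length_cons, List.length_map]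
    simp only [encStr] at h₁ h₂
    omega
  · refine .seq (by simpa using copy (symWord (ea x)) [] []) ?_
    refine .seq (((hf M false rfl x).2 _ 0 1 rfl).of_eq rfl rfl le_rfl) (.seq (.push _ _ _)
      (((hg M true rfl x).2 _ 3 1 ?_).of_eq rfl ?_ le_rfl))
    · simp
    · simp [encPair, encStr, symWord_bool]

end Closure

/-! ### Elementary string functions -/

/-- The calls of a program without calls. -/
abbrev noCalls : Empty → Callee := fun i => i.elim

/-- A function that is computed in linear time by a program without calls. -/
theorem polyTime_of_prog (p : Prog Empty) {α β Γ Δ : Type} [SymCode Γ] [SymCode Δ]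
    {ea : α → List Γ} {eb : β → List Δ} {f : α → β} (c : ℕ)
    (hlen : ∀ x, (eb (f x)).length ≤ c * ((ea x).length + 1))
    (h : ∀ x, Run noCalls p ![[], [], symWord (ea x), [], []]
      ![[], (symWord (eb (f x))).reverse, [], [], []] (c * ((ea x).length + 1))) :
    PolyTime ea eb f :=
  polyTime_of_run_two p (M := noCalls) (t := fun n => c * (n + 1))
    ⟨.C c * (.X + .C 1), fun n => by simp⟩ hlen h

section Basic

variable {α β Γ Δ : Type} [SymCode Γ] [SymCode Δ] {ea : α → List Γ} {eb : β → List Δ} {f : α → β}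

theorem polyTime_of_append (w : List Sym) (h : ∀ x, symWord (eb (f x)) = w ++ symWord (ea x)) :
    PolyTime ea eb f := by
  have hw : ∀ (w v u : List Sym), Run noCalls
      (w.foldr (fun a p => .seq (.push 1 a) p) (.move 2 1)) ![[], v, u, [], []]
      ![[], (w ++ u).reverse ++ v, [], [], []] (w.length + (2 * u.length + 1)) := by
    intro w
    induction w with
    | nil =>
      intro v u
      exact (run_move (by decide) u _ rfl).of_eq rfl (by simp) (by simp)
    | cons a w ih =>
      intro v u
      exact (Run.seq (.push 1 a _) ((ih (a :: v) u).of_eq (by simp) rfl le_rfl)).of_eq rfl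
        (by simp) (by simp only [List.length_cons]; omega)
  refine polyTime_of_run_two (M := noCalls)
    (w.foldr (fun a p => .seq (.push 1 a) p) (.move 2 1)) (t := fun n => w.length + (2 * n + 1))
    ((PolyBdd.const _).add (((PolyBdd.const 2).mul .id).add (.const 1)))
    (fun x => ?_) (fun x => ?_)
  · rw [← length_symWord, h, List.length_append, length_symWord]
    omega
  · refine (hw w [] (symWord (ea x))).of_eq rfl (by rw [h]; simp) ?_
    rw [length_symWord]

/-- Only the encodings enter, so the same program also removes the index bit from `encIdxPair`. -/
theorem polyTime_of_tail (h : ∀ x, symWord (eb (f x)) = (symWord (ea x)).tail) :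
    PolyTime ea eb f := by
  refine polyTime_of_prog (.pop 2 .skip fun _ => .move 2 1) 2 (fun x => ?_) (fun x => ?_)
  · rw [← length_symWord, h, List.length_tail, length_symWord]
    have : (ea x).length - 1 ≤ (ea x).length := Nat.sub_le _ _
    omega
  · rw [h, ← length_symWord (ea x)]
    generalize symWord (ea x) = u
    cases u with
    | nil => exact (Run.pop_nil rfl (.skip _)).of_eq rfl (by simp) (by simp)
    | cons a u =>
      refine (Run.pop_cons rfl (run_move (by decide) u _ (by simp))).of_eq rfl (by simp) ?_
      simp only [List.length_cons]
      omega

theorem polyTime_of_nil (h : ∀ x, eb (f x) = []) : PolyTime ea eb f := by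
  refine polyTime_of_prog (.clear 2) 2 (fun x => ?_) (fun x => ?_)
  · simp [h]
  · refine (run_clear 2 (symWord (ea x)) _ rfl).of_eq rfl (by simp [h, symWord]) ?_
    rw [length_symWord]
    omega

end Basic

theorem symWord_encPair (p : Str × Str) :
    symWord (encPair p) = p.1.map some ++ none :: p.2.map some := symWord_option _

theorem length_encPair (p : Str × Str) : (encPair p).length = p.1.length + 1 + p.2.length := by
  simp [encPair]; omega

/-- The separator triggers a loop that uses up the rest of register `2`, so the outer loop ends by
itself. The next programs for pairs use the same device. -/
theorem polyTime_fst : PolyTime encPair encStr Prod.fst := by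
  let body : Sym → Prog Empty := fun a => match a with
    | some b => .push 1 (some b)
    | none => .clear 2
  have key : ∀ (x : Str) (v y : List Sym), Run noCalls (.loop 2 body)
      ![[], v, x.map some ++ none :: y, [], []] ![[], (x.map some).reverse ++ v, [], [], []]
      (2 * x.length + 2 * y.length + 3) := by
    intro x
    induction x with
    | nil =>
      intro v y
      refine (Run.loop_cons rfl (run_clear 2 y _ (by simp)) (.loop_nil (by simp))).of_eq rfl
        (by simp) (by simp; omega)
    | cons b x ih =>
      intro v y
      refine (Run.loop_cons (body := body) (a := some b) rfl (.push 1 (some b) _) ((ih (some b :: v) y).of_eq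
        (by simp) rfl le_rfl)).of_eq rfl (by simp) (by simp only [List.length_cons]; omega)
  refine polyTime_of_prog (.loop 2 body) 3 (fun p => ?_) (fun p => ?_)
  · rw [length_encPair]
    show p.1.length ≤ _
    omega
  · rw [length_encPair, symWord_encPair]
    refine (key p.1 [] (p.2.map some)).of_eq rfl (by simp [encStr, symWord_bool]) ?_
    rw [List.length_map]
    omega

theorem polyTime_snd : PolyTime encPair encStr Prod.snd := by
  let body : Sym → Prog Empty := fun a => match a with
    | some _ => .skip
    | none => .move 2 1
  have key : ∀ (x : Str) (y : List Sym), Run noCalls (.loop 2 body)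
      ![[], [], x.map some ++ none :: y, [], []] ![[], y.reverse, [], [], []]
      (2 * x.length + 2 * y.length + 3) := by
    intro x
    induction x with
    | nil =>
      intro y
      refine (Run.loop_cons rfl (run_move (by decide) y _ (by simp)) (.loop_nil (by simp))).of_eq
        rfl (by simp) (by simp; omega)
    | cons b x ih =>
      intro y
      refine (Run.loop_cons rfl (.skip _) ((ih y).of_eq
        (by simp) rfl le_rfl)).of_eq rfl (by simp) (by simp only [List.length_cons]; omega)
  refine polyTime_of_prog (.loop 2 body) 3 (fun p => ?_) (fun p => ?_)
  · rw [length_encPair]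
    show p.2.length ≤ _
    omega
  · rw [length_encPair, symWord_encPair]
    refine (key p.1 (p.2.map some)).of_eq rfl (by simp [encStr, symWord_bool]) ?_
    rw [List.length_map]
    omega

theorem polyTime_append : PolyTime encPair encStr (fun p => p.1 ++ p.2) := by
  let body : Sym → Prog Empty := fun a => match a with
    | some b => .push 1 (some b)
    | none => .move 2 1
  have key : ∀ (x : Str) (v y : List Sym), Run noCalls (.loop 2 body)
      ![[], v, x.map some ++ none :: y, [], []]
      ![[], y.reverse ++ (x.map some).reverse ++ v, [], [], []]
      (2 * x.length + 2 * y.length + 3) := by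
    intro x
    induction x with
    | nil =>
      intro v y
      refine (Run.loop_cons rfl (run_move (by decide) y _ (by simp)) (.loop_nil (by simp))).of_eq
        rfl (by simp) (by simp; omega)
    | cons b x ih =>
      intro v y
      refine (Run.loop_cons (body := body) (a := some b) rfl (.push 1 (some b) _) ((ih (some b :: v) y).of_eq
        (by simp) rfl le_rfl)).of_eq rfl (by simp) (by simp only [List.length_cons]; omega)
  refine polyTime_of_prog (.loop 2 body) 3 (fun p => ?_) (fun p => ?_)
  · rw [length_encPair, encStr, List.length_append]
    omega
  · rw [length_encPair, symWord_encPair]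
    refine (key p.1 [] (p.2.map some)).of_eq rfl (by simp [encStr, symWord_bool]) ?_
    rw [List.length_map]
    omega

/-- This is the source of all conditionals: a truth value is passed as a one-bit string in front of
the separator. -/
theorem polyTime_select :
    PolyTime encPair encStr (fun p => if p.1 = [true] then p.2 else []) := by
  let last : Sym → Prog Empty := fun a => match a with
    | some _ => .clear 2
    | none => .move 2 1
  let body : Sym → Prog Empty := fun a => match a with
    | some true => .pop 2 .skip last
    | _ => .clear 2
  refine polyTime_of_prog (.pop 2 .skip body) 3 (fun p => ?_) (fun p => ?_)
  · have : (encStr (if p.1 = [true] then p.2 else [])).length ≤ p.2.length := by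
      split_ifs <;> simp [encStr]
    rw [length_encPair]
    omega
  · obtain ⟨x, y⟩ := p
    rw [length_encPair, symWord_encPair]
    rcases x with _ | ⟨_ | _, _ | ⟨b, x⟩⟩
    · refine (Run.pop_cons rfl (run_clear 2 (y.map some) _ (by simp))).of_eq rfl
        (by simp [encStr, symWord]) ?_
      simp; omega
    · refine (Run.pop_cons rfl (run_clear 2 (none :: y.map some) _ (by simp))).of_eq rfl
        (by simp [encStr, symWord]) ?_
      simp; omega
    · refine (Run.pop_cons rfl (run_clear 2 (some b :: (x.map some ++ none :: y.map some)) _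
        (by simp))).of_eq rfl (by simp [encStr, symWord]) ?_
      simp; omega
    · refine (Run.pop_cons rfl (Run.pop_cons (body := last) (a := none) (l := y.map some)
        (by simp)
        (run_move (by decide) (y.map some) _ (by simp)))).of_eq rfl
        (by simp [encStr, symWord_bool]) ?_
      simp; omega
    · refine (Run.pop_cons rfl (Run.pop_cons (body := last) (a := some b)
        (l := x.map some ++ none :: y.map some) (by simp)
        (run_clear 2 (x.map some ++ none :: y.map some) _ (by simp)))).of_eq rfl
        (by simp [encStr, symWord]) ?_
      simp; omega

/-! ### Coding pairs of strings as strings -/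

/-- An encoding of pairs of strings as strings. -/
def pairStr (x w : Str) : Str := x.flatMap (fun b => [true, b]) ++ false :: w

/-- The first component of an encoded pair. -/
def unpairFst : Str → Str
  | true :: b :: u => b :: unpairFst u
  | _ => []

/-- The second component of an encoded pair. -/
def unpairSnd : Str → Str
  | true :: _ :: u => unpairSnd u
  | false :: u => u
  | _ => []

@[simp] theorem unpairFst_pairStr (x w : Str) : unpairFst (pairStr x w) = x := by
  induction x with
  | nil => simp [pairStr, unpairFst]
  | cons b x ih => simpa [pairStr, unpairFst] using ih

@[simp] theorem unpairSnd_pairStr (x w : Str) : unpairSnd (pairStr x w) = w := by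
  induction x with
  | nil => simp [pairStr, unpairSnd]
  | cons b x ih => simpa [pairStr, unpairSnd] using ih

theorem length_pairStr (x w : Str) : (pairStr x w).length = 2 * x.length + 1 + w.length := by
  induction x with
  | nil => simp [pairStr]; omega
  | cons b x ih =>
    simp only [pairStr, List.flatMap_cons, List.length_append, List.length_cons] at ih ⊢
    simp; omega

theorem polyTime_unpairFst : PolyTime encStr encStr unpairFst := by
  let body : Sym → Prog Empty := fun a => match a with
    | some true => .pop 2 .skip fun b => .push 1 b
    | _ => .clear 2
  have key : ∀ (u : Str) (v : List Sym), (unpairFst u).length ≤ u.length ∧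
      Run noCalls (.loop 2 body) ![[], v, u.map some, [], []]
      ![[], ((unpairFst u).map some).reverse ++ v, [], [], []] (3 * u.length + 1) := by
    intro u
    induction u using unpairFst.induct with
    | case1 b u ih =>
      intro v
      obtain ⟨h₁, h₂⟩ := ih (some b :: v)
      refine ⟨by simp only [unpairFst, List.length_cons]; omega, ?_⟩
      refine (Run.loop_cons rfl (Run.pop_cons (l := u.map some) (by simp) (.push 1 (some b) _))
        (h₂.of_eq (by simp) rfl le_rfl)).of_eq rfl (by simp [unpairFst]) ?_
      simp only [List.length_cons]; omega
    | case2 u hu =>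
      intro v
      have e : unpairFst u = [] := unpairFst.eq_2 u hu
      refine ⟨by simp [e], ?_⟩
      rw [e]
      -- What remains is the empty string, a string starting with `false`, and the ill-formed string
      -- `[true]`.
      rcases u with _ | ⟨_ | _, u⟩
      · exact .loop_nil rfl
      · refine (Run.loop_cons rfl (run_clear 2 (u.map some) _ (by simp))
          (.loop_nil (by simp))).of_eq rfl (by simp) (by simp; omega)
      · rcases u with _ | ⟨b, u⟩
        · refine (Run.loop_cons rfl (Run.pop_nil (by simp) (.skip _))
            (.loop_nil (by simp))).of_eq rfl (by simp) (by simp)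
        · exact (hu b u rfl).elim
  refine polyTime_of_prog (.loop 2 body) 3 (fun u => ?_) (fun u => ?_)
  · have := (key u []).1
    simp only [encStr]
    omega
  · refine (key u []).2.of_eq rfl (by simp [encStr, symWord_bool]) ?_
    simp only [encStr]
    omega

theorem polyTime_unpairSnd : PolyTime encStr encStr unpairSnd := by
  let body : Sym → Prog Empty := fun a => match a with
    | some true => .pop 2 .skip fun _ => .skip
    | _ => .move 2 1
  have key : ∀ (u : Str), (unpairSnd u).length ≤ u.length ∧
      Run noCalls (.loop 2 body) ![[], [], u.map some, [], []]
      ![[], ((unpairSnd u).map some).reverse, [], [], []] (3 * u.length + 1) := by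
    intro u
    induction u using unpairSnd.induct with
    | case1 b u ih =>
      obtain ⟨h₁, h₂⟩ := ih
      refine ⟨by simp only [unpairSnd, List.length_cons]; omega, ?_⟩
      refine (Run.loop_cons rfl (Run.pop_cons (a := some b) (l := u.map some) (by simp) (.skip _))
        (h₂.of_eq (by simp) rfl le_rfl)).of_eq rfl (by simp [unpairSnd]) ?_
      simp only [List.length_cons]; omega
    | case2 u =>
      refine ⟨by simp [unpairSnd], ?_⟩
      exact (Run.loop_cons rfl (run_move (by decide) (u.map some) _ (by simp))
          (.loop_nil (by simp))).of_eq rfl (by simp [unpairSnd]) (by simp; omega)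
    | case3 u hu hu' =>
      have e : unpairSnd u = [] := unpairSnd.eq_3 u hu hu'
      refine ⟨by simp [e], ?_⟩
      rw [e]
      rcases u with _ | ⟨_ | _, u⟩
      · exact .loop_nil rfl
      · exact (hu' u rfl).elim
      · rcases u with _ | ⟨b, u⟩
        · refine (Run.loop_cons rfl (Run.pop_nil (by simp) (.skip _))
            (.loop_nil (by simp))).of_eq rfl (by simp) (by simp)
        · exact (hu b u rfl).elim
  refine polyTime_of_prog (.loop 2 body) 3 (fun u => ?_) (fun u => ?_)
  · have := (key u).1
    simp only [encStr]
    omega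
  · refine (key u).2.of_eq rfl (by simp [encStr, symWord_bool]) ?_
    simp only [encStr]
    omega

/-! ### Comparison and multiplication -/

/-- The treatment of one symbol of a pair that is taken apart. -/
def Prog.splitSym {ι : Type} : Sym → Prog ι
  | some b => .push 0 (some b)
  | none => .move 2 3

/-- The program that takes apart a pair of strings. -/
def Prog.split {ι : Type} : Prog ι := .loop 2 .splitSym

theorem run_split {ι : Type} {M : ι → Callee} (x : Str) : ∀ v y : List Sym, Run M .split
    ![v, [], x.map some ++ none :: y, [], []] ![(x.map some).reverse ++ v, [], [], y.reverse, []]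
    (2 * x.length + 2 * y.length + 3) := by
  induction x with
  | nil =>
    intro v y
    refine (Run.loop_cons rfl (run_move (by decide) y _ (by simp)) (.loop_nil (by simp))).of_eq
      rfl (by simp) (by simp; omega)
  | cons b x ih =>
    intro v y
    refine (Run.loop_cons (body := Prog.splitSym) (a := some b) rfl (.push 0 (some b) _) ((ih (some b :: v) y).of_eq
      (by simp) rfl le_rfl)).of_eq rfl (by simp) (by simp only [List.length_cons]; omega)

/-- For `s = true`, equality of two words; for `s = false`, comparison of their lengths. -/
def agree (s : Bool) : List Sym → List Sym → Bool
  | [], y => !s || y.isEmpty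
  | _ :: _, [] => false
  | a :: x, b :: y => (!s || a == b) && agree s x y

theorem agree_true (x y : List Sym) : agree true x y = true ↔ x = y := by
  induction x generalizing y with
  | nil => cases y <;> simp [agree]
  | cons a x ih => cases y <;> simp [agree, ih]

theorem agree_false (x y : List Sym) : agree false x y = true ↔ x.length ≤ y.length := by
  induction x generalizing y with
  | nil => simp [agree]
  | cons a x ih => cases y <;> simp [agree, ih]

/-- The words are consumed in parallel, and register `4` collects a symbol for every defect. A
remainder of the second word is a defect only if `s = true`. The answer is whether register `4`
stays empty. The words are reversed because `Prog.split` reverses them. -/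
theorem polyTime_agree (s : Bool) : PolyTime encPair encBool
    (fun p => agree s (p.1.map some).reverse (p.2.map some).reverse) := by
  let body : Sym → Prog Empty := fun a => .pop 3 (.push 4 none) fun b =>
    bif !s || a == b then .skip else .push 4 none
  have key : ∀ x y f : List Sym, ∃ y' f', Run noCalls (.loop 0 body) ![x, [], [], y, f]
      ![[], [], [], y', f'] (3 * x.length + 1) ∧ y'.length ≤ y.length ∧
      f'.length ≤ f.length + x.length ∧
      (f' = [] ∧ (s = true → y' = []) ↔ f = [] ∧ agree s x y = true) := by
    intro x
    induction x with
    | nil =>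
      intro y f
      exact ⟨y, f, .loop_nil rfl, le_rfl, le_rfl, by cases s <;> simp [agree]⟩
    | cons a x ih =>
      intro y f
      rcases y with _ | ⟨b, y⟩
      · obtain ⟨y', f', h, hy, hf, hiff⟩ := ih [] (none :: f)
        refine ⟨y', f', ?_, hy, ?_, ?_⟩
        · exact (Run.loop_cons (l := x) rfl (Run.pop_nil (by simp) (.push 4 none _))
            (h.of_eq (by simp) rfl le_rfl)).of_eq rfl rfl (by simp; omega)
        · simp at hf ⊢; omega
        · rw [hiff]; simp [agree]
      · cases hs : (!s || a == b)
        · obtain ⟨y', f', h, hy, hf, hiff⟩ := ih y (none :: f)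
          refine ⟨y', f', ?_, ?_, ?_, ?_⟩
          · refine (Run.loop_cons (l := x) rfl (Run.pop_cons (a := b) (l := y) (by simp)
              (t := 1) ?_) (h.of_eq rfl rfl le_rfl)).of_eq rfl rfl (by simp; omega)
            rw [hs]
            exact (Run.push 4 none _).of_eq rfl (by simp) le_rfl
          · simp; omega
          · simp at hf ⊢; omega
          · rw [hiff]; simp [agree, hs]
        · obtain ⟨y', f', h, hy, hf, hiff⟩ := ih y f
          refine ⟨y', f', ?_, ?_, ?_, ?_⟩
          · refine (Run.loop_cons (l := x) rfl (Run.pop_cons (a := b) (l := y) (by simp)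
              (t := 1) ?_) (h.of_eq rfl rfl le_rfl)).of_eq rfl rfl (by simp; omega)
            rw [hs]
            exact (Run.skip _).of_eq rfl (by simp) le_rfl
          · simp; omega
          · simp; omega
          · rw [hiff]; simp [agree, hs]
  let rest : Sym → Prog Empty := fun _ => bif s then .push 4 none else .skip
  have fin₁ : ∀ y f : List Sym, ∃ f', Run noCalls (.seq (.pop 3 .skip rest) (.clear 3))
      ![[], [], [], y, f] ![[], [], [], [], f'] (2 * y.length + 5) ∧ f'.length ≤ f.length + 1 ∧
      (f' = [] ↔ f = [] ∧ (s = true → y = [])) := by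
    intro y f
    rcases y with _ | ⟨b, y⟩
    · exact ⟨f, (Run.seq (.pop_nil rfl (.skip _)) (run_clear 3 [] _ rfl)).of_eq rfl (by simp)
        (by simp), by simp, by simp⟩
    · cases hs : s
      · refine ⟨f, (Run.seq (.pop_cons (body := rest) (a := b) (l := y) (t := 1) rfl
          (r' := ![[], [], [], y, f]) ?_)
          (run_clear 3 y _ (by simp))).of_eq rfl (by simp) (by simp; omega), by simp, by simp⟩
        simp only [rest, hs, cond_false]
        exact (Run.skip _).of_eq (by simp) rfl le_rfl
      · refine ⟨none :: f, (Run.seq (.pop_cons (body := rest) (a := b) (l := y) (t := 1) rfl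
          (r' := ![[], [], [], y, none :: f]) ?_)
          (run_clear 3 y _ (by simp))).of_eq rfl (by simp) (by simp; omega), by simp, by simp⟩
        simp only [rest, hs, cond_true]
        exact (Run.push 4 none _).of_eq rfl (by simp) le_rfl
  have fin₂ : ∀ f : List Sym, Run noCalls
      (.seq (.pop 4 (.push 1 (some true)) fun _ => .push 1 (some false)) (.clear 4))
      ![[], [], [], [], f] ![[], [some (f.isEmpty)], [], [], []] (2 * f.length + 3) := by
    intro f
    rcases f with _ | ⟨a, f⟩
    · exact (Run.seq (.pop_nil rfl (.push 1 (some true) _))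
        (run_clear 4 [] _ (by simp))).of_eq rfl (by simp) (by simp)
    · exact (Run.seq (.pop_cons (a := a) (body := fun _ => .push 1 (some false)) (l := f) rfl (.push 1 (some false) _))
        (run_clear 4 f _ (by simp))).of_eq rfl (by simp) (by simp; omega)
  refine polyTime_of_prog (.seq .split (.seq (.loop 0 body)
    (.seq (.seq (.pop 3 .skip rest) (.clear 3)) (.seq (.pop 4 (.push 1 (some true))
      fun _ => .push 1 (some false)) (.clear 4))))) 20 (fun p => ?_) (fun p => ?_)
  · simp [encBool]; omega
  · obtain ⟨y', f', h, hy, hf, hiff⟩ := key (p.1.map some).reverse (p.2.map some).reverse []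
    obtain ⟨g, h', hg, hiff'⟩ := fin₁ y' f'
    have hl : [some g.isEmpty] = (symWord (encBool
        (agree s (p.1.map some).reverse (p.2.map some).reverse))).reverse := by
      have : g.isEmpty = agree s (p.1.map some).reverse (p.2.map some).reverse := by
        rw [Bool.eq_iff_iff, List.isEmpty_iff, hiff', hiff]; simp
      rw [this]; simp [encBool, symWord_bool]
    rw [symWord_encPair, length_encPair, ← hl]
    refine (Run.seq ((run_split p.1 [] (p.2.map some)).of_eq rfl (by simp) le_rfl)
      (Run.seq h (Run.seq h' (fin₂ g)))).of_eq rfl rfl ?_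
    simp only [List.length_reverse, List.length_map, List.length_nil] at *
    omega

theorem polyTime_eq : PolyTime encPair encBool (fun p => decide (p.1 = p.2)) := by
  have h := polyTime_agree true
  have e : (fun p : Str × Str => agree true (p.1.map some).reverse (p.2.map some).reverse)
      = fun p => decide (p.1 = p.2) := by
    funext p
    rw [Bool.eq_iff_iff, agree_true, decide_eq_true_iff, List.reverse_inj,
      (List.map_injective_iff.2 (Option.some_injective Bool)).eq_iff]
  rwa [e] at h

theorem polyTime_length_le :
    PolyTime encPair encBool (fun p => decide (p.1.length ≤ p.2.length)) := by
  have h := polyTime_agree false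
  have e : (fun p : Str × Str => agree false (p.1.map some).reverse (p.2.map some).reverse)
      = fun p => decide (p.1.length ≤ p.2.length) := by
    funext p
    rw [Bool.eq_iff_iff, agree_false, decide_eq_true_iff]
    simp
  rwa [e] at h

/-- For each symbol of the second word, the first is moved to register `4` and back while one `true`
per symbol is written. -/
theorem polyTime_mul :
    PolyTime encPair encStr (fun p => List.replicate (p.1.length * p.2.length) true) := by
  let inner : Sym → Prog Empty := fun a => .seq (.push 4 a) (.push 1 (some true))
  let outer : Sym → Prog Empty := fun _ => .seq (.loop 0 inner) (.move 4 0)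
  have h₁ : ∀ x v y w : List Sym, Run noCalls (.loop 0 inner) ![x, v, [], y, w]
      ![[], List.replicate x.length (some true) ++ v, [], y, x.reverse ++ w]
      (3 * x.length + 1) := by
    intro x
    induction x with
    | nil => intro v y w; exact .loop_nil rfl
    | cons a x ih =>
      intro v y w
      refine (Run.loop_cons (l := x) rfl (.seq (.push 4 a _) (.push 1 (some true) _))
        ((ih (some true :: v) y (a :: w)).of_eq (by simp) rfl le_rfl)).of_eq rfl ?_ ?_
      · simp [List.replicate_succ']
      · simp only [List.length_cons]; omega
  have h₂ : ∀ x y v : List Sym, Run noCalls (.loop 3 outer) ![x, v, [], y, []]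
      ![x, List.replicate (x.length * y.length) (some true) ++ v, [], [], []]
      (y.length * (5 * x.length + 3) + 1) := by
    intro x y
    induction y with
    | nil => intro v; exact (Run.loop_nil rfl).of_eq rfl (by simp) (by simp)
    | cons b y ih =>
      intro v
      refine (Run.loop_cons (l := y) rfl (.seq ((h₁ x v y []).of_eq (by simp) rfl le_rfl)
        (run_move (by decide) x.reverse _ (by simp)))
        ((ih (List.replicate x.length (some true) ++ v)).of_eq (by simp) rfl le_rfl)).of_eq
        rfl ?_ ?_
      · simp [← List.append_assoc, Nat.mul_succ]
      · simp only [List.length_cons, List.length_reverse]; ring_nf; omega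
  refine polyTime_of_run_two (M := noCalls) (.seq .split (.seq (.loop 3 outer) (.clear 0)))
    (t := fun n => 2 * n + 3 + (n * (5 * n + 3) + 1) + (2 * n + 1))
    ⟨.C 2 * .X + .C 3 + (.X * (.C 5 * .X + .C 3) + .C 1) + (.C 2 * .X + .C 1), fun n => by simp⟩
    (fun p => ?_) (fun p => ?_)
  · have : p.1.length * p.2.length ≤ (encPair p).length * (encPair p).length :=
      Nat.mul_le_mul (by rw [length_encPair]; omega) (by rw [length_encPair]; omega)
    simp only [encStr, List.length_replicate]
    nlinarith
  · rw [symWord_encPair]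
    refine (Run.seq ((run_split p.1 [] (p.2.map some)).of_eq rfl (by simp) le_rfl)
      (Run.seq (h₂ (p.1.map some).reverse (p.2.map some).reverse [])
      (run_clear 0 (p.1.map some).reverse _ rfl))).of_eq rfl ?_ ?_
    · simp [encStr, symWord_bool]
    · have : p.2.length * (5 * p.1.length + 3)
          ≤ (encPair p).length * (5 * (encPair p).length + 3) :=
        Nat.mul_le_mul (by rw [length_encPair]; omega) (by rw [length_encPair]; omega)
      simp only [List.length_reverse, List.length_map]
      rw [length_encPair] at this ⊢
      omega

/-! ### Closure properties in pointwise form -/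

section Derived

variable {α Γ : Type} [SymCode Γ] {ea : α → List Γ}

theorem PolyTime.select {c : α → Bool} {f : α → Str} (hc : PolyTime ea encBool c)
    (hf : PolyTime ea encStr f) : PolyTime ea encStr (fun x => if c x = true then f x else []) := by
  -- The encoding of a truth value is literally that of a one-bit string, so the same machine
  -- serves.
  have h : PolyTime ea encStr (fun x => [c x]) := by
    obtain ⟨h⟩ := hc
    exact ⟨⟨h.toTM2ComputableAux, h.time, h.outputsFun⟩⟩
  simpa using polyTime_select.comp (h.fork hf)

theorem PolyTime.append {f g : α → Str} (hf : PolyTime ea encStr f) (hg : PolyTime ea encStr g) :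
    PolyTime ea encStr (fun x => f x ++ g x) :=
  polyTime_append.comp (hf.fork hg)

theorem PolyTime.prepend {f : α → Str} (hf : PolyTime ea encStr f) (w : Str) :
    PolyTime ea encStr (fun x => w ++ f x) :=
  (polyTime_of_append (f := fun x : Str => w ++ x) (ea := encStr) (eb := encStr) (w.map some)
    (fun x => by simp [encStr, symWord_bool])).comp hf

theorem PolyTime.tail {f : α → Str} (hf : PolyTime ea encStr f) :
    PolyTime ea encStr (fun x => (f x).tail) :=
  (polyTime_of_tail (f := fun x : Str => x.tail) (ea := encStr) (eb := encStr)
    (fun x => by simp [encStr, symWord_bool])).comp hf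

theorem PolyTime.drop {f : α → Str} (hf : PolyTime ea encStr f) (n : ℕ) :
    PolyTime ea encStr (fun x => (f x).drop n) := by
  induction n with
  | zero => simpa using hf
  | succ n ih => simpa using ih.tail

theorem PolyTime.const (w : Str) : PolyTime ea encStr (fun _ => w) := by
  have h : PolyTime ea encStr (fun _ => []) := polyTime_of_nil fun _ => rfl
  simpa using h.prepend w

theorem PolyTime.eq {f g : α → Str} (hf : PolyTime ea encStr f) (hg : PolyTime ea encStr g) :
    PolyTime ea encBool (fun x => decide (f x = g x)) :=
  polyTime_eq.comp (hf.fork hg)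

theorem PolyTime.length_le {f g : α → Str} (hf : PolyTime ea encStr f)
    (hg : PolyTime ea encStr g) :
    PolyTime ea encBool (fun x => decide ((f x).length ≤ (g x).length)) :=
  polyTime_length_le.comp (hf.fork hg)

/-- A polynomial bound is written in unary, so that a certificate length can be compared with it. -/
theorem PolyTime.replicate_eval {f : α → Str} (hf : PolyTime ea encStr f) (q : Polynomial ℕ) :
    PolyTime ea encStr (fun x => List.replicate (q.eval (f x).length) true) := by
  induction q using Polynomial.induction_on with
  | C a => simpa using PolyTime.const (List.replicate a true)
  | add p q hp hq => simpa using hp.append hq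
  | monomial n a h =>
    have := polyTime_mul.comp (h.fork hf)
    simpa [pow_succ, mul_assoc] using this

end Derived

theorem polyTime_id : PolyTime encStr encStr (fun x => x) :=
  polyTime_of_append [] fun _ => rfl

theorem polyTime_idxSnd : PolyTime encIdxPair encPair Prod.snd :=
  polyTime_of_tail fun t => by simp [encIdxPair]

/-! ### A one-way function of one argument from P ≠ NP -/

theorem classP_subset_classNP : ClassP ⊆ ClassNP := by
  rintro L ⟨d, hd, hL⟩
  refine ⟨0, fun p => d p.1, hd.comp polyTime_fst, fun x => ?_⟩
  rw [hL]
  exact ⟨fun h => ⟨[], by simp, h⟩, fun ⟨_, _, h⟩ => h⟩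

/-- If P and NP differ, then there is an honest polynomial-time computable function of one
argument that cannot be inverted in polynomial time. -/
theorem exists_oneWay (hPNP : ClassP ≠ ClassNP) : ∃ ρ : Str → Str, PolyTime encStr encStr ρ ∧
    (∃ q : Polynomial ℕ, ∀ u, ∃ u', u'.length ≤ q.eval (ρ u).length ∧ ρ u' = ρ u) ∧
    ¬ ∃ g : Str → Str, PolyTime encStr encStr g ∧ ∀ u, ρ (g (ρ u)) = ρ u := by
  obtain ⟨L, ⟨q, v, hv, hL⟩, hLP⟩ := Set.not_subset.1 fun h =>
    hPNP (classP_subset_classNP.antisymm h)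
  -- The leading `true` separates values that come from a valid certificate from the default value
  -- `[]`.
  let ρ : Str → Str := fun u =>
    if v (unpairFst u, unpairSnd u) = true then
      if decide ((unpairSnd u).length ≤ (List.replicate (q.eval (unpairFst u).length) true).length)
        = true then [true] ++ unpairFst u else []
    else []
  have hρ : PolyTime encStr encStr ρ :=
    (hv.comp (polyTime_unpairFst.fork polyTime_unpairSnd)).select
      ((polyTime_unpairSnd.length_le (polyTime_unpairFst.replicate_eval q)).select
        (polyTime_unpairFst.prepend [true]))
  have hρ_pair : ∀ x w, w.length ≤ q.eval x.length → v (x, w) = true →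
      ρ (pairStr x w) = true :: x := by
    intro x w hw hvx
    simp [ρ, hw, hvx]
  have hρ_cases : ∀ u, ρ u = [] ∨ ∃ x w, w.length ≤ q.eval x.length ∧ v (x, w) = true ∧
      ρ u = true :: x := by
    intro u
    by_cases h₁ : v (unpairFst u, unpairSnd u) = true
    · by_cases h₂ : (unpairSnd u).length ≤ q.eval (unpairFst u).length
      · exact .inr ⟨_, _, h₂, h₁, by simp [ρ, h₁, h₂]⟩
      · exact .inl (by simp [ρ, h₂])
    · exact .inl (by simp [ρ, h₁])
  refine ⟨ρ, hρ, ?_, ?_⟩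
  -- If the default value occurs, one fixed preimage of it serves, paid for by a constant. The other
  -- values have a coded pair as a preimage, of length `2 * x.length + 1 + w.length`.
  · by_cases hnil : ∃ u₀, ρ u₀ = []
    · obtain ⟨u₀, hu₀⟩ := hnil
      refine ⟨.C u₀.length + (2 * .X + 1 + q), fun u => ?_⟩
      rcases hρ_cases u with h | ⟨x, w, hw, hvx, h⟩
      · exact ⟨u₀, by simp [h], by rw [hu₀, h]⟩
      · refine ⟨pairStr x w, ?_, by rw [hρ_pair x w hw hvx, h]⟩
        have := eval_mono q (Nat.le_add_right x.length 1)
        rw [length_pairStr, h]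
        simp; omega
    · refine ⟨2 * .X + 1 + q, fun u => ?_⟩
      rcases hρ_cases u with h | ⟨x, w, hw, hvx, h⟩
      · exact (hnil ⟨u, h⟩).elim
      · refine ⟨pairStr x w, ?_, by rw [hρ_pair x w hw hvx, h]⟩
        have := eval_mono q (Nat.le_add_right x.length 1)
        rw [length_pairStr, h]
        simp; omega
  · rintro ⟨g, hg, hinv⟩
    -- A string `x` lies in `L` exactly if `true :: x` is a value of `ρ`, and applying `ρ` to the
    -- answer of the inverter tests this.
    refine hLP ⟨fun x => decide (ρ (g ([true] ++ x)) = [true] ++ x),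
      (hρ.comp (hg.comp (polyTime_id.prepend [true]))).eq (polyTime_id.prepend [true]),
      fun x => ?_⟩
    rw [hL, decide_eq_true_iff]
    constructor
    · rintro ⟨w, hw, hvx⟩
      have := hinv (pairStr x w)
      rwa [hρ_pair x w hw hvx] at this
    · intro h
      rcases hρ_cases (g ([true] ++ x)) with h' | ⟨x', w, hw, hvx, h'⟩
      · rw [h] at h'
        simp at h'
      · rw [h] at h'
        obtain rfl : x = x' := by simpa using h'
        exact ⟨w, hw, hvx⟩

/-! ### The two-argument function and its properties -/

section Sigma

variable (ρ : Str → Str)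

/-- The values at pairs with equal components. -/
def diagPart (a : Str) : Str :=
  -- Such an equation tests for a prefix, and at most one summand is nonempty, so appending acts as
  -- a case distinction. Both fit `PolyTime.eq`, `PolyTime.select` and `PolyTime.append`.
  (if decide (a = [false] ++ a.drop 1) = true then [false] ++ ρ (a.drop 1) else []) ++
    (if decide (a = [true, true, true] ++ a.drop 3) = true then [true] ++ a.drop 3 else [])

/-- The values at pairs `(10z, 110u)` with `ρ u = z`. -/
def crossPart (a b : Str) : Str :=
  if decide (b = [true, true, false] ++ b.drop 3) = true then
    if decide (a = [true, false] ++ ρ (b.drop 3)) = true then [true] ++ a.drop 2 else []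
  else []

/-- The function that is hard to invert from its value, hard to invert from its value and one
argument if this argument must be kept, but otherwise easy to invert from these data. -/
def hardSum (p : Str × Str) : Str :=
  (if decide (p.1 = p.2) = true then diagPart ρ p.1 else []) ++
    (crossPart ρ p.1 p.2 ++ crossPart ρ p.2 p.1)

variable {ρ}

theorem PolyTime.crossPart {α Γ : Type} [SymCode Γ] {ea : α → List Γ} {f g : α → Str}
    (hρ : PolyTime encStr encStr ρ) (hf : PolyTime ea encStr f) (hg : PolyTime ea encStr g) :
    PolyTime ea encStr (fun x => crossPart ρ (f x) (g x)) :=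
  (hg.eq ((hg.drop 3).prepend _)).select
    ((hf.eq ((hρ.comp (hg.drop 3)).prepend _)).select ((hf.drop 2).prepend _))

theorem polyTime_hardSum (hρ : PolyTime encStr encStr ρ) : PolyTimeComputable (hardSum ρ) := by
  have h₁ := polyTime_fst
  have h₂ := polyTime_snd
  refine .append ((h₁.eq h₂).select (.append ?_ ?_))
    (.append (hρ.crossPart h₁ h₂) (hρ.crossPart h₂ h₁))
  · exact (h₁.eq ((h₁.drop 1).prepend _)).select ((hρ.comp (h₁.drop 1)).prepend _)
  · exact (h₁.eq ((h₁.drop 3).prepend _)).select ((h₁.drop 3).prepend _)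

theorem crossPart_cases (a b : Str) : crossPart ρ a b = [] ∨
    ∃ u, a = true :: false :: ρ u ∧ b = true :: true :: false :: u := by
  by_cases hb : b = [true, true, false] ++ b.drop 3
  · by_cases ha : a = [true, false] ++ ρ (b.drop 3)
    · exact .inr ⟨b.drop 3, ha, hb⟩
    · exact .inl (by rw [crossPart, if_pos (decide_eq_true hb), if_neg (by simpa using ha)])
  · exact .inl (by rw [crossPart, if_neg (by simpa using hb)])

theorem diagPart_cases (a : Str) : diagPart ρ a = [] ∨
    (∃ u, a = false :: u) ∨ ∃ z, a = true :: true :: true :: z := by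
  rcases a with _ | ⟨_ | _, _ | ⟨_ | _, _ | ⟨_ | _, a⟩⟩⟩ <;> simp [diagPart]

theorem hardSum_comm (a b : Str) : hardSum ρ (a, b) = hardSum ρ (b, a) := by
  by_cases h : a = b
  · rw [h]
  · have h' : ¬ b = a := fun e => h e.symm
    simp only [hardSum, h, h', decide_false, Bool.false_eq_true, if_false, List.nil_append]
    rcases crossPart_cases (ρ := ρ) a b with e | ⟨u, rfl, rfl⟩
    · rw [e]; simp
    -- The prefixes 10 and 110 differ in the second bit, so the two cross parts are never both
    -- nonempty and their order does not matter.
    · have : crossPart ρ (true :: true :: false :: u) (true :: false :: ρ u) = [] := by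
        simp [crossPart]
      rw [this]; simp

@[simp] theorem hardSum_false (u : Str) :
    hardSum ρ (false :: u, false :: u) = false :: ρ u := by
  simp [hardSum, diagPart, crossPart]

@[simp] theorem hardSum_true (z : Str) :
    hardSum ρ (true :: true :: true :: z, true :: true :: true :: z) = true :: z := by
  simp [hardSum, diagPart, crossPart]

@[simp] theorem hardSum_cross (u : Str) :
    hardSum ρ (true :: false :: ρ u, true :: true :: false :: u) = true :: ρ u := by
  simp [hardSum, crossPart]

@[simp] theorem hardSum_nil (a : Str) : hardSum ρ (a, []) = [] := by
  cases a <;> simp [hardSum, diagPart, crossPart]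

theorem hardSum_cases (a b : Str) : hardSum ρ (a, b) = [] ∨
    (∃ u, a = false :: u ∧ b = false :: u) ∨
    (∃ z, a = true :: true :: true :: z ∧ b = true :: true :: true :: z) ∨
    (∃ u, a = true :: false :: ρ u ∧ b = true :: true :: false :: u) ∨
    ∃ u, a = true :: true :: false :: u ∧ b = true :: false :: ρ u := by
  rcases crossPart_cases (ρ := ρ) a b with h₁ | ⟨u, ha, hb⟩
  · rcases crossPart_cases (ρ := ρ) b a with h₂ | ⟨u, hb, ha⟩
    · by_cases h : a = b
      · subst h
        rcases diagPart_cases (ρ := ρ) a with h₃ | ⟨u, rfl⟩ | ⟨z, rfl⟩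
        · exact .inl (by simp [hardSum, h₁, h₃])
        · exact .inr (.inl ⟨u, rfl, rfl⟩)
        · exact .inr (.inr (.inl ⟨z, rfl, rfl⟩))
      · exact .inl (by simp [hardSum, h₁, h₂, h])
    · exact .inr (.inr (.inr (.inr ⟨u, ha, hb⟩)))
  · exact .inr (.inr (.inr (.inl ⟨u, ha, hb⟩)))

theorem honest_hardSum {q : Polynomial ℕ}
    (hq : ∀ u, ∃ u', u'.length ≤ q.eval (ρ u).length ∧ ρ u' = ρ u) : Honest (hardSum ρ) := by
  -- Two copies of 0u' with a short u' need `2 * q` and a constant; two copies of 111z need `2 * .X`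
  -- and a constant.
  refine ⟨2 * q + 2 * .X + 8, ?_⟩
  have htrue : ∀ z : Str, ∃ a b : Str, a.length + b.length ≤
      (2 * q + 2 * .X + 8 : Polynomial ℕ).eval (true :: z).length ∧
      hardSum ρ (a, b) = true :: z := fun z =>
    ⟨true :: true :: true :: z, true :: true :: true :: z, by simp; omega, by simp⟩
  rintro z ⟨⟨a, b⟩, hz⟩
  rcases hardSum_cases (ρ := ρ) a b with h | ⟨u, rfl, rfl⟩ | ⟨y, rfl, rfl⟩ | ⟨u, rfl, rfl⟩ |
    ⟨u, rfl, rfl⟩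
  · exact ⟨[], [], by simp, by rw [← hz, h]; simp⟩
  · obtain ⟨u', hu', hρu⟩ := hq u
    rw [hardSum_false] at hz
    refine ⟨false :: u', false :: u', ?_, by rw [← hz, hardSum_false, hρu]⟩
    have := eval_mono q (Nat.le_add_right (ρ u).length 1)
    rw [← hz]
    simp; omega
  · rw [hardSum_true] at hz
    exact hz ▸ htrue y
  · rw [hardSum_cross] at hz
    exact hz ▸ htrue (ρ u)
  · rw [hardSum_comm, hardSum_cross] at hz
    exact hz ▸ htrue (ρ u)

/-- Only the given argument 10ρ(u) is critical: its partner 110u may be long, but u can be replaced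
by a short u' with the same value of ρ. Commutativity reduces the second half to the first. -/
theorem sHonest_hardSum {q : Polynomial ℕ}
    (hq : ∀ u, ∃ u', u'.length ≤ q.eval (ρ u).length ∧ ρ u' = ρ u) : SHonest (hardSum ρ) := by
  obtain ⟨p, key⟩ : ∃ p : Polynomial ℕ, ∀ z a : Str, (∃ b, hardSum ρ (a, b) = z) →
      ∃ b', b'.length ≤ p.eval (z.length + a.length) ∧ hardSum ρ (a, b') = z := by
    refine ⟨q + .X + 8, ?_⟩
    rintro z a ⟨b, hz⟩
    rcases hardSum_cases (ρ := ρ) a b with h | ⟨u, rfl, rfl⟩ | ⟨y, rfl, rfl⟩ | ⟨u, rfl, rfl⟩ |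
      ⟨u, rfl, rfl⟩
    · exact ⟨[], by simp, by rw [← hz, h]; simp⟩
    · exact ⟨_, by simp; omega, hz⟩
    · exact ⟨_, by simp; omega, hz⟩
    · obtain ⟨u', hu', hρu⟩ := hq u
      refine ⟨true :: true :: false :: u', ?_, ?_⟩
      · have := eval_mono q (m := (ρ u).length)
          (n := z.length + (true :: false :: ρ u).length) (by simp; omega)
        simp at this ⊢; omega
      · rw [← hz, hardSum_cross, ← hρu, hardSum_cross]
    · refine ⟨true :: false :: ρ u, ?_, hz⟩
      have hz' : true :: ρ u = z := by rw [← hz, hardSum_comm, hardSum_cross]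
      have hl : z.length = (ρ u).length + 1 := by rw [← hz', List.length_cons]
      simp; omega
  refine ⟨p, key, fun z b h => ?_⟩
  obtain ⟨a', ha', h'⟩ := key z b (h.imp fun a ha => by rw [hardSum_comm, ha])
  exact ⟨a', ha', by rw [hardSum_comm, h']⟩

theorem hardSum_eq_false {a b z : Str} (h : hardSum ρ (a, b) = false :: z) :
    ∃ u, a = false :: u ∧ b = false :: u ∧ ρ u = z := by
  rcases hardSum_cases (ρ := ρ) a b with h' | ⟨u, rfl, rfl⟩ | ⟨y, rfl, rfl⟩ | ⟨u, rfl, rfl⟩ |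
    ⟨u, rfl, rfl⟩
  · simp [h'] at h
  · exact ⟨u, rfl, rfl, by simpa using h⟩
  · simp at h
  · simp at h
  · rw [hardSum_comm] at h
    simp at h

/-- The prefix 10 of the kept argument excludes the easy preimage (111z, 111z). -/
theorem hardSum_eq_true {b y z : Str} (h : hardSum ρ (true :: false :: y, b) = true :: z) :
    ∃ u, b = true :: true :: false :: u ∧ ρ u = z := by
  rcases hardSum_cases (ρ := ρ) (true :: false :: y) b with h' | ⟨u, h', rfl⟩ | ⟨y, h', rfl⟩ |
    ⟨u, h', rfl⟩ | ⟨u, h', rfl⟩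
  · simp [h'] at h
  · simp at h'
  · simp at h'
  · rw [h'] at h
    exact ⟨u, rfl, by simpa using h⟩
  · simp at h'

/-- Every preimage of 0z is a pair (0u, 0u) with ρ(u) = z, so an inverter of σ yields one of ρ. -/
theorem noninvertible_hardSum
    (hinv : ¬ ∃ g : Str → Str, PolyTime encStr encStr g ∧ ∀ u, ρ (g (ρ u)) = ρ u) :
    Noninvertible (hardSum ρ) := by
  rintro ⟨g, hg, h⟩
  refine hinv ⟨fun z => (g ([false] ++ z)).1.drop 1,
    (polyTime_fst.comp (hg.comp (polyTime_id.prepend [false]))).drop 1, fun u => ?_⟩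
  obtain ⟨u', h₁, -, h₂⟩ := hardSum_eq_false (h (false :: ρ u) ⟨_, hardSum_false u⟩)
  simp [h₁, h₂]

/-- The query with argument 10z and value 1z can be formed from z alone, and a correct answer is
110u with ρ(u) = z. -/
theorem not_invertibleFirst_hardSum
    (hinv : ¬ ∃ g : Str → Str, PolyTime encStr encStr g ∧ ∀ u, ρ (g (ρ u)) = ρ u) :
    ¬ InvertibleFirst (hardSum ρ) := by
  rintro ⟨g, hg, h⟩
  refine hinv ⟨fun z => (g ([true, false] ++ z, [true] ++ z)).drop 3,
    (hg.comp ((polyTime_id.prepend _).fork (polyTime_id.prepend _))).drop 3, fun u => ?_⟩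
  obtain ⟨u', h₁, h₂⟩ := hardSum_eq_true
    (h (true :: ρ u) ⟨_, hardSum_cross u⟩ _ _ (hardSum_cross u))
  simp [h₁, h₂]

/-- It suffices to output pairs with equal components: the given argument twice for a value starting
with 0, 111z twice for 1z, and two empty strings for the empty value. By commutativity the index can
be ignored. -/
theorem not_overstrong_hardSum : ¬ Overstrong (hardSum ρ) := by
  let k : Str × Str → Str := fun p =>
    (if decide (p.1 = [false] ++ p.1.drop 1) = true then p.2 else []) ++
      (if decide (p.1 = [true] ++ p.1.drop 1) = true then [true, true, true] ++ p.1.drop 1 else [])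
  have hk : PolyTime encPair encStr k := by
    have h₁ := polyTime_fst
    exact .append ((h₁.eq ((h₁.drop 1).prepend _)).select polyTime_snd)
      ((h₁.eq ((h₁.drop 1).prepend _)).select ((h₁.drop 1).prepend _))
  refine not_not_intro ⟨fun t => (k t.2, k t.2), (hk.fork hk).comp polyTime_idxSnd, ?_⟩
  intro i z a h
  obtain ⟨b, hb⟩ : ∃ b, hardSum ρ (a, b) = z := by
    obtain ⟨b, ⟨h, -⟩ | ⟨h, -⟩⟩ := h
    · exact ⟨b, h⟩
    · exact ⟨b, by rw [hardSum_comm, h]⟩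
  rcases z with _ | ⟨_ | _, z⟩
  · simp [k]
  · obtain ⟨u, rfl, rfl, rfl⟩ := hardSum_eq_false hb
    simp [k]
  · simp [k]

end Sigma

end PolyOneWay

theorem theorem3p7 (hPNP : PolyOneWay.ClassP ≠ PolyOneWay.ClassNP) :
    ∃ σ : PolyOneWay.Str × PolyOneWay.Str → PolyOneWay.Str,
      PolyOneWay.PolyTimeComputable σ ∧
      PolyOneWay.Honest σ ∧
      PolyOneWay.SHonest σ ∧
      (∀ a b : PolyOneWay.Str, σ (a, b) = σ (b, a)) ∧
      PolyOneWay.Noninvertible σ ∧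
      PolyOneWay.StronglyNoninvertible σ ∧
      ¬ PolyOneWay.Overstrong σ := by
  obtain ⟨ρ, hρ, ⟨q, hq⟩, hinv⟩ := PolyOneWay.exists_oneWay hPNP
  have hfirst := PolyOneWay.not_invertibleFirst_hardSum hinv
  refine ⟨PolyOneWay.hardSum ρ, PolyOneWay.polyTime_hardSum hρ, PolyOneWay.honest_hardSum hq,
    PolyOneWay.sHonest_hardSum hq, PolyOneWay.hardSum_comm,
    PolyOneWay.noninvertible_hardSum hinv, ⟨hfirst, ?_⟩, PolyOneWay.not_overstrong_hardSum⟩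
  -- By commutativity, an inverter for the second kind of query is also one for the first.
  rintro ⟨g, hg, h⟩
  refine hfirst ⟨g, hg, fun z hz a b hab => ?_⟩
  rw [PolyOneWay.hardSum_comm]
  exact h z hz b a (by rw [PolyOneWay.hardSum_comm, hab])
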